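/- Let $R$ be an associative unital ring with $1\neq 0$ and let $G$ be a group. A character of $G$ is a homomorphism $\chi\colon G\to\mathbb R$; for $N\leqslant G$ let $S(G,N)$ be the set of non-zero characters vanishing on $N$. The Novikov ring $\widehat{R[G]}^{\chi}$ consists of the formal series $\sum_{g\in G} r_g g$ ($r_g\in R$) such that $\{g : r_g\neq 0,\ \chi(g)\leqslant t\}$ is finite for every $t\in\mathbb R$; it is a left $R[G]$-module by left multiplication. For a chain complex $C_\bullet$ of left modules over a ring and a left module $M$, $H^i(C_\bullet;M)$ is the $i$th cohomology of $\mathrm{Hom}(C_\bullet,M)$, and $\mathrm{cd}(C_\bullet)$ is the supremum in $\mathbb Z\cup\{\pm\infty\}$ of all $i$ such that $H^i(C_\bullet;M)\neq 0$ for some $M$. Write $H^i(G;M)=\mathrm{Ext}^i_{R[G]}(R,M)$ and let $\mathrm{cd}_R(G)$ be the projective dimension of the trivial left $R[G]$-module $R$. If $\mathrm{cd}_R(G)=n<\infty$ and $m\geqslant 0$, then $G$ is of type $\mathrm{FP}^*_m(R)$ if the trivial $R[G]$-module $R$ has a projective resolution $P_\bullet$ with $P_i$ finitely generated for all $i>n-m$,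 and $$\Sigma^*_m(G;R)=\{\chi\colon G\to\mathbb R \text{ a non-zero character} : H^i(G;\widehat{R[G]}^{\chi})=0\text{ for all } i>n-m\}.$$ **Theorem.** 1. (Groups) Let $d, n\geqslant 0$ be integers, let $G$ be of type $\mathrm{FP}^*_d(R)$ with $\mathrm{cd}_R(G)=n$, and let $N\trianglelefteqslant G$ be a normal subgroup with $G/N\cong\mathbb Z^d$. If $S(G,N)\subseteq\Sigma^*_d(G;R)$, then $\mathrm{cd}_R(N)=n-d$ (in particular $d\leqslant n$). 2. (Chain complexes) Let $C_\bullet=(C_i)_{i\in\mathbb Z}$ be a chain complex of finitely generated projective left $R[G]$-modules such that $C_i=0$ for all $i>n$, for some $n\in\mathbb Z$, and let $\chi\colon G\to\mathbb R$ be a character whose image is free Abelian of rank $d$. If $H^i(C_\bullet;\widehat{R[G]}^{\varphi})=0$ for all $\varphi\in S(G,\ker\chi)$ and all $i>n-d$, then the restriction of $C_\bullet$ to $R[\ker\chi]$ satisfies $\mathrm{cd}(\mathrm{res}^G_{\ker\chi}C_\bullet)\leqslant n-d$. -/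

import Mathlib

universe u v

open CategoryTheory

noncomputable section

namespace CoAbelian

/-! ### The trivial module and cohomology of groups -/

/-- The augmentation `R[G] → R`, `∑ r_g g ↦ ∑ r_g`, for an arbitrary (not necessarily commutative)
ring `R`. -/
def augmentation (R : Type u) (G : Type v) [Ring R] [Group G] : MonoidAlgebra R G →+* R :=
  MonoidAlgebra.liftNCRingHom (RingHom.id R) 1 (fun _ _ => Commute.one_right _)

/-- The additive group `R`, lifted to the universe of `R[G]`; it carries the trivial `G`-action. -/
def TrivialCarrier (R : Type u) (_G : Type v) : Type (max u v) := ULift.{v} R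

instance (R : Type u) (G : Type v) [Ring R] : AddCommGroup (TrivialCarrier R G) :=
  inferInstanceAs (AddCommGroup (ULift.{v} R))

instance (R : Type u) (G : Type v) [Ring R] : Module R (TrivialCarrier R G) :=
  inferInstanceAs (Module R (ULift.{v} R))

instance (R : Type u) (G : Type v) [Ring R] [Group G] :
    Module (MonoidAlgebra R G) (TrivialCarrier R G) :=
  Module.compHom (TrivialCarrier R G) (augmentation R G)

/-- The trivial left `R[G]`-module `R`. -/
abbrev trivialModule (R : Type u) (G : Type v) [Ring R] [Group G] :
    ModuleCat.{max u v} (MonoidAlgebra R G) :=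
  ModuleCat.of (MonoidAlgebra R G) (TrivialCarrier R G)

/-- The cohomology `H^i(G; M) = Ext^i_{R[G]}(R, M)` of `G` over `R` with coefficients in the left
`R[G]`-module `M`. -/
abbrev groupCohom (R : Type u) (G : Type v) [Ring R] [Group G]
    (M : ModuleCat.{max u v} (MonoidAlgebra R G)) (i : ℕ) : Type (max u v) :=
  Abelian.Ext.{max u v} (trivialModule R G) M i

/-- The cohomological dimension `cd_R(G)`: the projective dimension of the trivial `R[G]`-module
`R`, i.e. the supremum of all `i` with `H^i(G; M) ≠ 0` for some `M`. -/
def cd (R : Type u) (G : Type v) [Ring R] [Group G] : WithBot ℕ∞ :=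
  projectiveDimension (trivialModule R G)

/-- `G` is of type `FP*_m(R)`: `cd_R(G) = n` is finite and the trivial `R[G]`-module `R` has a
projective resolution `P` with `P_i` finitely generated for all `i > n - m`. -/
def IsFPStar (R : Type u) (G : Type v) [Ring R] [Group G] (m : ℕ) : Prop :=
  ∃ n : ℕ, cd R G = n ∧ ∃ P : ProjectiveResolution (trivialModule R G),
    ∀ i : ℕ, (n : ℤ) - m < i → Module.Finite (MonoidAlgebra R G) (P.complex.X i)

/-! ### Characters and Novikov rings -/

/-- Real characters of `G`, i.e. elements of `H^1(G; ℝ)`. The trivial character is `1`. -/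
abbrev Character (G : Type v) [Group G] : Type v := G →* Multiplicative ℝ

/-- The set `S(G, N)` of non-zero characters vanishing on `N`. -/
def charactersVanishingOn {G : Type v} [Group G] (N : Subgroup G) : Set (Character G) :=
  {χ | χ ≠ 1 ∧ ∀ g ∈ N, χ g = 1}

section Novikov

variable (R : Type u) {G : Type v} [Ring R] [Group G]

/-- The additive group underlying the Novikov ring of `R[G]` with respect to `χ`: formal series
`∑ r_g g`, i.e. functions `G → R`, such that for each `t` only finitely many `g` in the support
satisfy `χ(g) ≤ t`. -/
def novikov (χ : Character G) : AddSubgroup (G → R) where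
  carrier := {f | ∀ t : ℝ, {g : G | f g ≠ 0 ∧ (χ g).toAdd ≤ t}.Finite}
  zero_mem' := fun t => by simp
  add_mem' := by
    intro a b ha hb t
    refine ((ha t).union (hb t)).subset ?_
    rintro g ⟨hg, ht⟩
    by_cases h : a g = 0
    · right
      refine ⟨fun h' => hg ?_, ht⟩
      simp [h, h']
    · exact Or.inl ⟨h, ht⟩
  neg_mem' := by
    intro a ha t
    simpa using ha t

/-- Left multiplication of series by scalars: `r · ∑ r_g g = ∑ r r_g g`. -/
def novikovScalar (χ : Character G) : R →+* AddMonoid.End (novikov R χ) where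
  toFun r :=
    { toFun := fun f => ⟨fun h => r * f.1 h, fun t => (f.2 t).subset fun g hg =>
        ⟨fun h0 => hg.1 (by simp [h0]), hg.2⟩⟩
      map_zero' := by ext; simp
      map_add' := by intros; ext; simp [mul_add] }
  map_one' := AddMonoidHom.ext fun f => Subtype.ext (funext fun h => one_mul _)
  map_zero' := AddMonoidHom.ext fun f => Subtype.ext (funext fun h => zero_mul _)
  map_mul' _ _ := AddMonoidHom.ext fun f => Subtype.ext (funext fun h => mul_assoc _ _ _)
  map_add' _ _ := AddMonoidHom.ext fun f => Subtype.ext (funext fun h => add_mul _ _ _)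

/-- Left multiplication of series by group elements: `x · ∑ r_g g = ∑ r_g xg`; the coefficient at
`h` of the result is `r_{x⁻¹h}`. -/
def novikovTranslate (χ : Character G) : G →* AddMonoid.End (novikov R χ) where
  toFun x :=
    { toFun := fun f => ⟨fun h => f.1 (x⁻¹ * h), fun t => by
        refine ((f.2 (t - (χ x).toAdd)).image (x * ·)).subset ?_
        rintro g ⟨hg, ht⟩
        refine ⟨x⁻¹ * g, ⟨hg, ?_⟩, by simp⟩
        simp only [map_mul, map_inv, toAdd_mul, toAdd_inv]
        linarith⟩
      map_zero' := by ext; simp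
      map_add' := by intros; ext; simp }
  map_one' := AddMonoidHom.ext fun f => Subtype.ext (funext fun h => 
    show f.1 (1⁻¹ * h) = f.1 h by simp)
  map_mul' x y := AddMonoidHom.ext fun f => Subtype.ext (funext fun h => 
    show f.1 ((x * y)⁻¹ * h) = f.1 (y⁻¹ * (x⁻¹ * h)) by simp [mul_assoc])

theorem novikov_commute (χ : Character G) (r : R) (x : G) :
    Commute (novikovScalar R χ r) (novikovTranslate R χ x) :=
  AddMonoidHom.ext fun _ => rfl

/-- The ring homomorphism describing left multiplication of `R[G]` on its Novikov ring. -/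
def novikovAction (χ : Character G) : MonoidAlgebra R G →+* AddMonoid.End (novikov R χ) :=
  MonoidAlgebra.liftNCRingHom (novikovScalar R χ) (novikovTranslate R χ) (novikov_commute R χ)

instance (χ : Character G) : Module (MonoidAlgebra R G) (novikov R χ) :=
  Module.compHom (novikov R χ) (novikovAction R χ)

/-- The left `R[G]`-module structure is left multiplication: `(r g) · f` has coefficient
`r f(g⁻¹h)` at `h`. -/
theorem novikov_single_smul_apply (χ : Character G) (g h : G) (r : R) (f : novikov R χ) :
    (MonoidAlgebra.single g r • f).1 h = r * f.1 (g⁻¹ * h) := by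
  change (novikovAction R χ (MonoidAlgebra.single g r) f).1 h = _
  rw [novikovAction, MonoidAlgebra.liftNCRingHom_single]
  rfl

/-- The Novikov ring as a left `R[G]`-module (by left multiplication); this is the structure
that enters as coefficients in cohomology. -/
abbrev novikovModule (χ : Character G) : ModuleCat.{max u v} (MonoidAlgebra R G) :=
  ModuleCat.of (MonoidAlgebra R G) (novikov R χ)

/-- The invariant `Σ*_m(G; R)`: the non-zero characters `χ` with vanishing Novikov cohomology
`H^i(G; R[G]^χ)` in all degrees `i > cd_R(G) - m`. -/
def sigmaStar (G : Type v) [Group G] (m : ℕ) : Set (Character G) :=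
  {χ | χ ≠ 1 ∧ ∀ i : ℕ, cd R G < ((i + m : ℕ) : WithBot ℕ∞) →
    Subsingleton (groupCohom R G (novikovModule R χ) i)}

end Novikov

/-! ### Cohomology and cohomological dimension of chain complexes -/

section Complex

universe w w'

variable {A : Type w} [Ring A]

/-- The degree `i` cocycles of `Hom_A(C, M)`. -/
def cocycles (C : ChainComplex (ModuleCat.{w'} A) ℤ) (M : ModuleCat.{w'} A) (i : ℤ) :
    AddSubgroup (C.X i ⟶ M) where
  carrier := {f | C.d (i + 1) i ≫ f = 0}
  zero_mem' := by simp
  add_mem' := by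
    intro a b ha hb
    simp_all [Preadditive.comp_add]
  neg_mem' := by
    intro a ha
    simp_all [Preadditive.comp_neg]

/-- The degree `i` coboundaries of `Hom_A(C, M)`. -/
def coboundaries (C : ChainComplex (ModuleCat.{w'} A) ℤ) (M : ModuleCat.{w'} A) (i : ℤ) :
    AddSubgroup (C.X i ⟶ M) where
  carrier := {f | ∃ h : C.X (i - 1) ⟶ M, C.d i (i - 1) ≫ h = f}
  zero_mem' := ⟨0, by simp⟩
  add_mem' := by
    rintro _ _ ⟨a, rfl⟩ ⟨b, rfl⟩
    exact ⟨a + b, by simp [Preadditive.comp_add]⟩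
  neg_mem' := by
    rintro _ ⟨a, rfl⟩
    exact ⟨-a, by simp [Preadditive.comp_neg]⟩

/-- The cohomology `H^i(C; M)` of the cochain complex `Hom_A(C, M)`. -/
abbrev cohomology (C : ChainComplex (ModuleCat.{w'} A) ℤ) (M : ModuleCat.{w'} A) (i : ℤ) :
    Type w' :=
  cocycles C M i ⧸ (coboundaries C M i).addSubgroupOf (cocycles C M i)

/-- The cohomological dimension of a chain complex of `A`-modules: the supremum, among the extended
integers, of all `i` with `H^i(C; M) ≠ 0` for some `A`-module `M`
(it is `⊥` if there is no such `i`). -/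
def complexCd (C : ChainComplex (ModuleCat.{w'} A) ℤ) : WithBot (WithTop ℤ) :=
  sSup {k | ∃ i : ℤ, (∃ M : ModuleCat.{w'} A, Nontrivial (cohomology C M i)) ∧
    k = ((i : WithTop ℤ) : WithBot (WithTop ℤ))}

end Complex

/-- The restriction `res_N^G C` of a chain complex of `R[G]`-modules to `R[N]`. -/
def resComplex (R : Type u) {G : Type v} [Ring R] [Group G] (N : Subgroup G)
    (C : ChainComplex (ModuleCat.{max u v} (MonoidAlgebra R G)) ℤ) :
    ChainComplex (ModuleCat.{max u v} (MonoidAlgebra R N)) ℤ :=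
  ((ModuleCat.restrictScalars.{max u v}
    (MonoidAlgebra.mapDomainRingHom R N.subtype)).mapHomologicalComplex _).obj C

end CoAbelian

end

/-!
Choose a surjection `θ : G → ℤ^r` with kernel `N`. Over any module `A`, the cohomology of `C` with
coefficients in functions `G → A` supported where a character `χ` is bounded below is controlled
by the Novikov ring of `χ`: vanishing of Novikov cohomology in the degrees `i ≥ m` yields
`R[G]`-linear maps that contract `C` up to an error shifting supports by a positive amount of `χ`,
and the Neumann series of the error turns cocycles into coboundaries. Positivity on a finite set is
an open condition, so the same maps serve all characters near `χ`, hence all finite families of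
nearby characters simultaneously. Mayer–Vietoris sequences over midpoint subdivisions in `ℝ^r` pass
from families of small diameter to families of signed basis vectors, and descend from these to the
empty family, which imposes no support condition; each of the `r` dimensions costs one degree.

A function whose support is bounded below for `χ` and one bounded below for `-χ` add up to an
arbitrary function, so the module obtained at the end is the one coinduced from `N`, and Shapiro's
lemma bounds `cd` of the restriction by `n - r`. In the opposite direction, the difference operators
`F ↦ t F(· t) - F` for lifts `t` of the basis of `ℤ^r` interpolate between coinduction from `N` and
from `G`, so each of the `r` coordinates raises the cohomological dimension by at most one.
-/

noncomputable section

namespace CoAbelian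

universe w w'

/-! ### Functions on a group and their supports -/

section GroupRing

variable {R : Type u} {G : Type v} [Ring R] [Group G]

/-- An additive map between `R[G]`-modules which commutes with all monomials, as an `R[G]`-linear
map. -/
def linearMapOfSingle {M : Type w} {M' : Type w'} [AddCommGroup M] [AddCommGroup M']
    [Module (MonoidAlgebra R G) M] [Module (MonoidAlgebra R G) M'] (f : M →+ M')
    (hf : ∀ (g : G) (r : R) (x : M),
      f (MonoidAlgebra.single g r • x) = MonoidAlgebra.single g r • f x) :
    M →ₗ[MonoidAlgebra R G] M' where
  toFun := f
  map_add' := f.map_add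
  map_smul' c x := by
    induction c using MonoidAlgebra.induction_linear with
    | zero => simp only [zero_smul, map_zero]
    | add a b ha hb => simp_all only [add_smul, map_add, RingHom.id_apply]
    | single g r => exact hf g r x

end GroupRing

/-- The functions `G → A`; over a ring `R` acting on `A` they form an `R[G]`-module by left
translation. A copy of the function type, so that `R[G]` does not also act pointwise. -/
structure TranslationModule (G : Type v) (A : Type w) : Type (max v w) where
  /-- The underlying function. -/
  toFun : G → A

namespace TranslationModule

variable {R : Type u} {G : Type v} {A : Type w}

/-- Functions as elements of the translation module. -/
def equivFun : TranslationModule G A ≃ (G → A) := ⟨toFun, mk, fun _ => rfl, fun _ => rfl⟩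

instance : FunLike (TranslationModule G A) G A :=
  ⟨toFun, equivFun.injective⟩

@[ext] theorem ext {F F' : TranslationModule G A} (h : ∀ g, F g = F' g) : F = F' :=
  DFunLike.ext F F' h

variable [AddCommGroup A]

instance : AddCommGroup (TranslationModule G A) := equivFun.addCommGroup

instance : IsZeroApply (TranslationModule G A) G A := ⟨fun _ => rfl⟩

instance : IsAddApply (TranslationModule G A) G A := ⟨fun _ _ _ => rfl⟩

instance : IsSubApply (TranslationModule G A) G A := ⟨fun _ _ _ => rfl⟩

variable [Group G]

/-- The action of the group on functions by left translation. -/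
def translate : G →* AddMonoid.End (TranslationModule G A) where
  toFun x :=
    { toFun := fun F => ⟨fun h => F (x⁻¹ * h)⟩
      map_zero' := rfl
      map_add' := fun _ _ => rfl }
  map_one' := AddMonoidHom.ext fun F => ext fun h =>
    show F (1⁻¹ * h) = F h by rw [inv_one, one_mul]
  map_mul' x y := AddMonoidHom.ext fun F => ext fun h =>
    show F ((x * y)⁻¹ * h) = F (y⁻¹ * (x⁻¹ * h)) by rw [mul_inv_rev, mul_assoc]

variable [Ring R] [Module R A]

/-- The pointwise action of scalars on functions. -/
def scalar : R →+* AddMonoid.End (TranslationModule G A) where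
  toFun r :=
    { toFun := fun F => ⟨fun h => r • F h⟩
      map_zero' := ext fun _ => smul_zero r
      map_add' := fun F F' => ext fun h => smul_add r (F h) (F' h) }
  map_one' := AddMonoidHom.ext fun F => ext fun h => one_smul R (F h)
  map_zero' := AddMonoidHom.ext fun F => ext fun h => zero_smul R (F h)
  map_mul' r s := AddMonoidHom.ext fun F => ext fun h => mul_smul r s (F h)
  map_add' r s := AddMonoidHom.ext fun F => ext fun h => add_smul r s (F h)

theorem scalar_commute_translate (r : R) (x : G) :
    Commute (scalar r) (translate (A := A) x) :=
  AddMonoidHom.ext fun _ => rfl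

/-- The action of the group ring on functions that combines `scalar` and `translate`. -/
def action : MonoidAlgebra R G →+* AddMonoid.End (TranslationModule G A) :=
  MonoidAlgebra.liftNCRingHom scalar translate scalar_commute_translate

instance : Module (MonoidAlgebra R G) (TranslationModule G A) :=
  Module.compHom (TranslationModule G A) (action (A := A))

@[simp] theorem single_smul_apply (g : G) (r : R) (F : TranslationModule G A) (h : G) :
    (MonoidAlgebra.single g r • F) h = r • F (g⁻¹ * h) := by
  change action (MonoidAlgebra.single g r) F h = _
  rw [action, MonoidAlgebra.liftNCRingHom_single]
  rfl

theorem smul_apply_eq_sum (x : MonoidAlgebra R G) (F : TranslationModule G A) (h : G) :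
    (x • F) h = x.coeff.sum fun g r => r • F (g⁻¹ * h) := by
  induction x using MonoidAlgebra.induction_linear with
  | zero => simp only [zero_smul, zero_apply, MonoidAlgebra.coeff_zero, Finsupp.sum_zero_index]
  | add a b ha hb =>
    rw [add_smul, add_apply, ha, hb, MonoidAlgebra.coeff_add, Finsupp.sum_add_index']
    · exact fun _ => zero_smul R _
    · exact fun _ _ _ => add_smul _ _ _
  | single g r =>
    rw [single_smul_apply, MonoidAlgebra.coeff_single, Finsupp.sum_single_index]
    exact zero_smul R _

variable (R G) in
/-- The inclusion of the group ring into the functions on the group. -/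
def ofAlgebra : MonoidAlgebra R G →ₗ[MonoidAlgebra R G] TranslationModule G R :=
  linearMapOfSingle
    { toFun := fun f => ⟨fun h => f.coeff h⟩
      map_zero' := rfl
      map_add' := fun _ _ => rfl }
    fun g r f => ext fun h =>
      (MonoidAlgebra.coeff_single_mul_apply f r g h).trans (single_smul_apply g r ⟨f.coeff⟩ h).symm

theorem ofAlgebra_apply (x : MonoidAlgebra R G) (h : G) : ofAlgebra R G x h = x.coeff h := rfl

section Supports

variable {χ : Character G} {F : TranslationModule G A} {t t' : ℝ}

variable (A) in
/-- The functions vanishing wherever the character `χ` takes a value less than `t`. -/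
def supportedAbove (χ : Character G) (t : ℝ) : AddSubgroup (TranslationModule G A) where
  carrier := {F | ∀ h, F h ≠ 0 → t ≤ (χ h).toAdd}
  zero_mem' _ h := (h rfl).elim
  add_mem' {F F'} hF hF' h hh := by
    by_contra hlt
    have hFh : F h = 0 := not_not.1 (mt (hF h) hlt)
    have hFh' : F' h = 0 := not_not.1 (mt (hF' h) hlt)
    exact hh (by rw [add_apply, hFh, hFh', add_zero])
  neg_mem' {F} hF h hh := hF h (neg_ne_zero.1 hh)

theorem supportedAbove_mono (h : t' ≤ t) : supportedAbove A χ t ≤ supportedAbove A χ t' :=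
  fun _ hF g hg => h.trans (hF g hg)

theorem apply_eq_zero_of_lt (hF : F ∈ supportedAbove A χ t) {h : G} (hh : (χ h).toAdd < t) :
    F h = 0 :=
  not_not.1 (mt (hF h) hh.not_ge)

theorem smul_mem_supportedAbove {δ : ℝ} {x : MonoidAlgebra R G}
    (hx : ∀ g ∈ x.coeff.support, δ ≤ (χ g).toAdd) (hF : F ∈ supportedAbove A χ t) :
    x • F ∈ supportedAbove A χ (t + δ) := by
  intro h hh
  rw [smul_apply_eq_sum] at hh
  obtain ⟨g, hg, hgF⟩ := Finset.exists_ne_zero_of_sum_ne_zero hh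
  have hδ := hx g hg
  have ht := hF (g⁻¹ * h) fun h0 => hgF (by simp only [h0, smul_zero])
  simp only [map_mul, map_inv, toAdd_mul, toAdd_inv] at ht
  linarith

theorem exists_le_toAdd (χ : Character G) (T : Finset G) : ∃ δ : ℝ, ∀ g ∈ T, δ ≤ (χ g).toAdd :=
  let ⟨δ, hδ⟩ := (T.finite_toSet.image fun g => (χ g).toAdd).bddBelow
  ⟨δ, fun _ hg => hδ (Set.mem_image_of_mem _ hg)⟩

variable (R A) in
/-- The functions whose support is bounded below with respect to the character `χ`. -/
def boundedBelow (χ : Character G) : Submodule (MonoidAlgebra R G) (TranslationModule G A) where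
  carrier := {F | ∃ t, F ∈ supportedAbove A χ t}
  zero_mem' := ⟨0, zero_mem _⟩
  add_mem' := by
    rintro F F' ⟨t, ht⟩ ⟨t', ht'⟩
    exact ⟨min t t', add_mem (supportedAbove_mono (min_le_left _ _) ht)
      (supportedAbove_mono (min_le_right _ _) ht')⟩
  smul_mem' := by
    rintro x F ⟨t, ht⟩
    obtain ⟨δ, hδ⟩ := exists_le_toAdd χ x.coeff.support
    exact ⟨t + δ, smul_mem_supportedAbove hδ ht⟩

variable (R A) in
/-- The functions with finitely many support points in each sublevel set of `χ`. -/
def novikovSubmodule (χ : Character G) :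
    Submodule (MonoidAlgebra R G) (TranslationModule G A) where
  carrier := {F | ∀ t : ℝ, {g : G | F g ≠ 0 ∧ (χ g).toAdd ≤ t}.Finite}
  zero_mem' t := Set.finite_empty.subset fun _ hg => hg.1 rfl
  add_mem' {F F'} hF hF' t := by
    refine ((hF t).union (hF' t)).subset ?_
    rintro g ⟨hg, ht⟩
    by_cases h0 : F g = 0
    · exact Or.inr ⟨fun h0' => hg (by rw [add_apply, h0, h0', add_zero]), ht⟩
    · exact Or.inl ⟨h0, ht⟩
  smul_mem' x F hF t := by
    refine (x.coeff.support.finite_toSet.biUnion fun g _ =>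
      (hF (t - (χ g).toAdd)).image (g * ·)).subset ?_
    rintro h ⟨hh, ht⟩
    rw [smul_apply_eq_sum] at hh
    obtain ⟨g, hg, hgF⟩ := Finset.exists_ne_zero_of_sum_ne_zero hh
    refine Set.mem_iUnion₂.2 ⟨g, hg, g⁻¹ * h, ⟨fun h0 => hgF (by simp only [h0, smul_zero]), ?_⟩,
      mul_inv_cancel_left g h⟩
    simp only [map_mul, map_inv, toAdd_mul, toAdd_inv]
    linarith

variable (R) in
/-- The Novikov ring as a module of functions on the group. -/
def novikovEquiv (χ : Character G) :
    novikov R χ ≃ₗ[MonoidAlgebra R G] novikovSubmodule R R χ :=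
  { linearMapOfSingle
      { toFun := fun f => (⟨⟨f.1⟩, f.2⟩ : novikovSubmodule R R χ)
        map_zero' := rfl
        map_add' := fun _ _ => rfl }
      fun g r f => Subtype.ext <| ext fun h =>
        (novikov_single_smul_apply R χ g h r f).trans
          (single_smul_apply g r (mk f.1) h).symm with
    invFun := fun F => ⟨F.1.toFun, F.2⟩
    left_inv := fun _ => rfl
    right_inv := fun _ => rfl }

theorem ofAlgebra_mem_novikovSubmodule (χ : Character G) (x : MonoidAlgebra R G) :
    ofAlgebra R G x ∈ novikovSubmodule R R χ := fun _ =>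
  x.coeff.support.finite_toSet.subset fun _ hg => Finsupp.mem_support_iff.2 hg.1

theorem novikovSubmodule_le_boundedBelow (χ : Character G) :
    novikovSubmodule R A χ ≤ boundedBelow R A χ := fun F hF => by
  obtain ⟨δ, hδ⟩ := exists_le_toAdd χ (hF 0).toFinset
  refine ⟨min δ 0, fun h hh => ?_⟩
  by_cases h0 : (χ h).toAdd ≤ 0
  · exact (min_le_left _ _).trans (hδ h ((hF 0).mem_toFinset.2 ⟨hh, h0⟩))
  · exact (min_le_right _ _).trans (not_le.1 h0).le

end Supports

end TranslationModule

open TranslationModule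

/-! ### Vanishing of cohomology -/

section Vanishing

variable {B : Type u} [Ring B] {C : ChainComplex (ModuleCat.{w} B) ℤ} {i j k : ℤ}
variable {M : Type w'} [AddCommGroup M] [Module B M]
variable {M' : Type*} [AddCommGroup M'] [Module B M']
variable {M'' : Type*} [AddCommGroup M''] [Module B M'']

/-- `H^i(C; M) = 0`: every degree `i` cocycle is a coboundary. In contrast to `cohomology`, the
module `M` may live in any universe. -/
def CohomologyVanishes (C : ChainComplex (ModuleCat.{w} B) ℤ) (M : Type w') [AddCommGroup M]
    [Module B M] (i : ℤ) : Prop :=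
  ∀ f : C.X i →ₗ[B] M, f ∘ₗ (C.d (i + 1) i).hom = 0 →
    ∃ h : C.X (i - 1) →ₗ[B] M, h ∘ₗ (C.d i (i - 1)).hom = f

theorem d_apply_d (C : ChainComplex (ModuleCat.{w} B) ℤ) (i j k : ℤ) (x : C.X i) :
    (C.d j k).hom ((C.d i j).hom x) = 0 :=
  LinearMap.congr_fun (congrArg ModuleCat.Hom.hom (C.d_comp_d i j k)) x

theorem d_hom_comp_d_hom (C : ChainComplex (ModuleCat.{w} B) ℤ) (i j k : ℤ) :
    (C.d j k).hom ∘ₗ (C.d i j).hom = 0 :=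
  LinearMap.ext (d_apply_d C i j k)

theorem subsingleton_cohomology_iff {M : ModuleCat.{w} B} :
    Subsingleton (cohomology C M i) ↔ CohomologyVanishes C M i := by
  rw [QuotientAddGroup.subsingleton_iff, AddSubgroup.addSubgroupOf_eq_top]
  refine ⟨fun h f hf => ?_, fun h f hf => ?_⟩
  · obtain ⟨k, hk⟩ := h (show ModuleCat.ofHom f ∈ cocycles C M i from ModuleCat.hom_ext hf)
    exact ⟨k.hom, congrArg ModuleCat.Hom.hom hk⟩
  · obtain ⟨k, hk⟩ := h f.hom (congrArg ModuleCat.Hom.hom hf)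
    exact ⟨ModuleCat.ofHom k, ModuleCat.hom_ext hk⟩

theorem complexCd_le_iff {m : ℤ} :
    complexCd C ≤ ((m : WithTop ℤ) : WithBot (WithTop ℤ)) ↔
      ∀ i, m < i → ∀ M : ModuleCat.{w} B, CohomologyVanishes C M i := by
  simp only [complexCd, sSup_le_iff, Set.mem_ofPred_eq, ← subsingleton_cohomology_iff,
    ← not_nontrivial_iff_subsingleton]
  constructor
  · intro h i hi M hM
    exact hi.not_ge (WithTop.coe_le_coe.1 (WithBot.coe_le_coe.1 (h _ ⟨i, ⟨M, hM⟩, rfl⟩)))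
  · rintro h _ ⟨i, ⟨M, hM⟩, rfl⟩
    exact WithBot.coe_le_coe.2 (WithTop.coe_le_coe.2 (not_lt.1 fun hi => h i hi M hM))

variable {f : M' →ₗ[B] M} {g : M →ₗ[B] M''}

theorem exists_comp_eq_of_exact {P : Type*} [AddCommGroup P] [Module B P]
    (hf : Function.Injective f) (hfg : Function.Exact f g) (k : P →ₗ[B] M) (hk : g ∘ₗ k = 0) :
    ∃ k' : P →ₗ[B] M', f ∘ₗ k' = k := by
  have hrange : ∀ x, k x ∈ LinearMap.range f := fun x => (hfg (k x)).1 (LinearMap.congr_fun hk x)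
  refine ⟨(LinearEquiv.ofInjective f hf).symm ∘ₗ k.codRestrict _ hrange, LinearMap.ext fun x => ?_⟩
  exact congrArg Subtype.val ((LinearEquiv.ofInjective f hf).apply_symm_apply ⟨k x, hrange x⟩)

theorem exact_prod_inclusion_coprod_inclusion (S₁ S₂ : Submodule B M) :
    Function.Exact
      ((Submodule.inclusion inf_le_left).prod (-Submodule.inclusion inf_le_right) :
        ↥(S₁ ⊓ S₂) →ₗ[B] S₁ × S₂)
      ((Submodule.inclusion le_sup_left).coprod (Submodule.inclusion le_sup_right) :
        S₁ × S₂ →ₗ[B] ↥(S₁ ⊔ S₂)) := by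
  rintro ⟨⟨x, hx⟩, ⟨y, hy⟩⟩
  constructor
  · intro h
    have hxy : x = -y := eq_neg_of_add_eq_zero_left (congrArg Subtype.val h)
    exact ⟨⟨x, hx, hxy ▸ neg_mem hy⟩, Prod.ext rfl (Subtype.ext (neg_eq_iff_eq_neg.2 hxy))⟩
  · rintro ⟨z, hz⟩
    obtain ⟨rfl, rfl⟩ := Prod.ext_iff.1 hz |>.imp (congrArg Subtype.val) (congrArg Subtype.val)
    exact Subtype.ext (add_neg_cancel z.1)

theorem injective_prod_inclusion (S₁ S₂ : Submodule B M) : Function.Injective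
    ((Submodule.inclusion inf_le_left).prod (-Submodule.inclusion inf_le_right) :
      ↥(S₁ ⊓ S₂) →ₗ[B] S₁ × S₂) :=
  fun _ _ h => Subtype.ext (congrArg (fun z => z.1.1) h)

theorem surjective_coprod_inclusion (S₁ S₂ : Submodule B M) : Function.Surjective
    ((Submodule.inclusion le_sup_left).coprod (Submodule.inclusion le_sup_right) :
      S₁ × S₂ →ₗ[B] ↥(S₁ ⊔ S₂)) := by
  rintro ⟨z, hz⟩
  obtain ⟨x, hx, y, hy, rfl⟩ := Submodule.mem_sup.1 hz
  exact ⟨(⟨x, hx⟩, ⟨y, hy⟩), rfl⟩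

namespace CohomologyVanishes

theorem exists_primitive (h : CohomologyVanishes C M j) (hi : i = j + 1) (hk : k = j - 1)
    (f : C.X j →ₗ[B] M) (hf : f ∘ₗ (C.d i j).hom = 0) :
    ∃ g : C.X k →ₗ[B] M, g ∘ₗ (C.d j k).hom = f := by
  subst hi hk
  exact h f hf

theorem of_linearEquiv (h : CohomologyVanishes C M i) (e : M ≃ₗ[B] M') :
    CohomologyVanishes C M' i := by
  intro f hf
  obtain ⟨g, hg⟩ := h (e.symm ∘ₗ f) (by rw [LinearMap.comp_assoc, hf, LinearMap.comp_zero])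
  refine ⟨e ∘ₗ g, ?_⟩
  rw [LinearMap.comp_assoc, hg, ← LinearMap.comp_assoc, LinearEquiv.comp_symm, LinearMap.id_comp]

theorem prod (h : CohomologyVanishes C M i) (h' : CohomologyVanishes C M' i) :
    CohomologyVanishes C (M × M') i := by
  intro f hf
  obtain ⟨g, hg⟩ := h (LinearMap.fst B M M' ∘ₗ f)
    (by rw [LinearMap.comp_assoc, hf, LinearMap.comp_zero])
  obtain ⟨g', hg'⟩ := h' (LinearMap.snd B M M' ∘ₗ f)
    (by rw [LinearMap.comp_assoc, hf, LinearMap.comp_zero])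
  exact ⟨g.prod g', LinearMap.ext fun x =>
    Prod.ext (LinearMap.congr_fun hg x) (LinearMap.congr_fun hg' x)⟩

variable [∀ i, Module.Projective B (C.X i)]

theorem of_exact_left (hf : Function.Injective f) (hfg : Function.Exact f g)
    (hg : Function.Surjective g) (h : CohomologyVanishes C M i)
    (h'' : CohomologyVanishes C M'' (i - 1)) : CohomologyVanishes C M' i := by
  intro z hz
  obtain ⟨k, hk⟩ := h (f ∘ₗ z) (by rw [LinearMap.comp_assoc, hz, LinearMap.comp_zero])
  obtain ⟨l, hl⟩ := h''.exists_primitive (sub_add_cancel i 1).symm rfl (g ∘ₗ k) (by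
    rw [LinearMap.comp_assoc, hk, ← LinearMap.comp_assoc, hfg.linearMap_comp_eq_zero,
      LinearMap.zero_comp])
  obtain ⟨l', rfl⟩ := Module.projective_lifting_property g l hg
  obtain ⟨k', hk'⟩ := exists_comp_eq_of_exact hf hfg (k - l' ∘ₗ (C.d (i - 1) (i - 1 - 1)).hom)
    (by rw [LinearMap.comp_sub, ← LinearMap.comp_assoc, hl, sub_self])
  refine ⟨k', LinearMap.cancel_left hf |>.1 ?_⟩
  rw [← LinearMap.comp_assoc, hk', LinearMap.sub_comp, hk, LinearMap.comp_assoc, d_hom_comp_d_hom,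
    LinearMap.comp_zero, sub_zero]

theorem of_exact_right (hf : Function.Injective f) (hfg : Function.Exact f g)
    (hg : Function.Surjective g) (h : CohomologyVanishes C M i)
    (h' : CohomologyVanishes C M' (i + 1)) : CohomologyVanishes C M'' i := by
  intro z hz
  obtain ⟨k, rfl⟩ := Module.projective_lifting_property g z hg
  obtain ⟨k', hk'⟩ := exists_comp_eq_of_exact hf hfg (k ∘ₗ (C.d (i + 1) i).hom)
    (by rw [← LinearMap.comp_assoc, hz])
  obtain ⟨l, rfl⟩ := h'.exists_primitive rfl (add_sub_cancel_right i 1).symm k'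
    (LinearMap.cancel_left hf |>.1 (by
      rw [← LinearMap.comp_assoc, hk', LinearMap.comp_assoc, d_hom_comp_d_hom,
        LinearMap.comp_zero, LinearMap.comp_zero]))
  obtain ⟨m, hm⟩ := h (k - f ∘ₗ l)
    (by rw [LinearMap.sub_comp, LinearMap.comp_assoc, hk', sub_self])
  refine ⟨g ∘ₗ m, ?_⟩
  rw [LinearMap.comp_assoc, hm, LinearMap.comp_sub, ← LinearMap.comp_assoc,
    hfg.linearMap_comp_eq_zero, LinearMap.zero_comp, sub_zero]

variable {S₁ S₂ : Submodule B M}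

theorem inf (h₁ : CohomologyVanishes C S₁ i) (h₂ : CohomologyVanishes C S₂ i)
    (h : CohomologyVanishes C ↥(S₁ ⊔ S₂) (i - 1)) : CohomologyVanishes C ↥(S₁ ⊓ S₂) i :=
  (h₁.prod h₂).of_exact_left (injective_prod_inclusion S₁ S₂)
    (exact_prod_inclusion_coprod_inclusion S₁ S₂) (surjective_coprod_inclusion S₁ S₂) h

theorem sup (h₁ : CohomologyVanishes C S₁ i) (h₂ : CohomologyVanishes C S₂ i)
    (h : CohomologyVanishes C ↥(S₁ ⊓ S₂) (i + 1)) : CohomologyVanishes C ↥(S₁ ⊔ S₂) i :=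
  (h₁.prod h₂).of_exact_right (injective_prod_inclusion S₁ S₂)
    (exact_prod_inclusion_coprod_inclusion S₁ S₂) (surjective_coprod_inclusion S₁ S₂) h

end CohomologyVanishes

end Vanishing

/-! ### Neumann series -/

section Neumann

open Filter

variable {R : Type u} {G : Type v} [Ring R] [Group G]
variable {A : Type w'} [AddCommGroup A] [Module R A]
variable {P : Type w} [AddCommGroup P] [Module (MonoidAlgebra R G) P]
variable {F : P →ₗ[MonoidAlgebra R G] TranslationModule G A} {ε : P →ₗ[MonoidAlgebra R G] P}

/-- The series `∑ F ∘ ε ^ k` is locally finite: at every argument and every group element only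
finitely many terms are non-zero. -/
def IsLocallyFiniteSeries (F : P →ₗ[MonoidAlgebra R G] TranslationModule G A)
    (ε : P →ₗ[MonoidAlgebra R G] P) : Prop :=
  ∀ p h, ∀ᶠ k in atTop, F ((ε ^ k) p) h = 0

theorem IsLocallyFiniteSeries.eventually_finsum_eq (hF : IsLocallyFiniteSeries F ε) (p : P)
    (h : G) : ∀ᶠ K in atTop,
      ∑ᶠ k, F ((ε ^ k) p) h = (∑ k ∈ Finset.range K, F ((ε ^ k) p)) h := by
  obtain ⟨K₀, hK₀⟩ := eventually_atTop.1 (hF p h)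
  filter_upwards [eventually_ge_atTop K₀] with K hK
  rw [sum_apply]
  refine finsum_eq_sum_of_support_subset _ fun k hk => ?_
  rw [Finset.coe_range, Set.mem_Iio]
  exact lt_of_not_ge fun hKk => hk (hK₀ k (hK.trans hKk))

/-- The pointwise sum of the series `∑ F ∘ ε ^ k`. -/
def neumannSum (hF : IsLocallyFiniteSeries F ε) :
    P →ₗ[MonoidAlgebra R G] TranslationModule G A :=
  linearMapOfSingle
    { toFun := fun p => ⟨fun h => ∑ᶠ k, F ((ε ^ k) p) h⟩
      map_zero' := ext fun h => finsum_eq_zero_of_forall_eq_zero fun k => by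
        rw [map_zero, map_zero, zero_apply]
      map_add' := fun p q => ext fun h => by
        change ∑ᶠ k, F ((ε ^ k) (p + q)) h = ∑ᶠ k, F ((ε ^ k) p) h + ∑ᶠ k, F ((ε ^ k) q) h
        obtain ⟨K, hpq, hp, hq⟩ := ((hF.eventually_finsum_eq (p + q) h).and
          ((hF.eventually_finsum_eq p h).and (hF.eventually_finsum_eq q h))).exists
        rw [hpq, hp, hq, ← add_apply, ← Finset.sum_add_distrib]
        simp only [map_add] }
    fun x r p => ext fun h => by
      rw [single_smul_apply]
      change ∑ᶠ k, F ((ε ^ k) (MonoidAlgebra.single x r • p)) h =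
        r • ∑ᶠ k, F ((ε ^ k) p) (x⁻¹ * h)
      obtain ⟨K, hxp, hp⟩ := ((hF.eventually_finsum_eq (MonoidAlgebra.single x r • p) h).and
        (hF.eventually_finsum_eq p (x⁻¹ * h))).exists
      rw [hxp, hp]
      simp only [map_smul, ← Finset.smul_sum, single_smul_apply]

theorem eventually_neumannSum_apply (hF : IsLocallyFiniteSeries F ε) (p : P) (h : G) :
    ∀ᶠ K in atTop, neumannSum hF p h = (∑ k ∈ Finset.range K, F ((ε ^ k) p)) h :=
  hF.eventually_finsum_eq p h

theorem neumannSum_sub_neumannSum_apply (hF : IsLocallyFiniteSeries F ε) (p : P) :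
    neumannSum hF p - neumannSum hF (ε p) = F p := by
  ext h
  obtain ⟨K, hp, hεp⟩ := (((tendsto_add_atTop_nat 1).eventually
    (eventually_neumannSum_apply hF p h)).and (eventually_neumannSum_apply hF (ε p) h)).exists
  simp only [sub_apply, hp, hεp, Finset.sum_range_succ', add_apply, pow_succ,
    Module.End.mul_apply, pow_zero, Module.End.one_apply, add_sub_cancel_left]

theorem neumannSum_eq_zero (hF : IsLocallyFiniteSeries F ε) {p : P}
    (hp : ∀ k, F ((ε ^ k) p) = 0) : neumannSum hF p = 0 := by
  ext h
  obtain ⟨K, hK⟩ := (eventually_neumannSum_apply hF p h).exists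
  rw [hK, Finset.sum_eq_zero fun k _ => hp k]

theorem neumannSum_sub_sum_mem_supportedAbove (hF : IsLocallyFiniteSeries F ε) {χ : Character G}
    {t : ℝ} {p : P} {K : ℕ} (hK : ∀ k ≥ K, F ((ε ^ k) p) ∈ supportedAbove A χ t) :
    neumannSum hF p - ∑ k ∈ Finset.range K, F ((ε ^ k) p) ∈ supportedAbove A χ t := by
  intro h hh
  obtain ⟨K', hK', hKK'⟩ :=
    ((eventually_neumannSum_apply hF p h).and (eventually_ge_atTop K)).exists
  rw [sub_apply, hK', ← sub_apply, ← Finset.sum_range_add_sum_Ico _ hKK', add_sub_cancel_left] at hh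
  exact sum_mem (fun k hk => hK k (Finset.mem_Ico.1 hk).1) h hh

/-- With respect to some finite generating family, `ε` is given by a matrix over `R[G]` whose
entries are supported in `T`. -/
def IsSupportedIn (T : Finset G) (ε : P →ₗ[MonoidAlgebra R G] P) : Prop :=
  ∃ (n : ℕ) (x : Fin n → P) (c : Fin n → Fin n → MonoidAlgebra R G),
    Submodule.span (MonoidAlgebra R G) (Set.range x) = ⊤ ∧
    (∀ a, ε (x a) = ∑ b, c a b • x b) ∧ ∀ a b, (c a b).coeff.support ⊆ T

theorem exists_pos_le_toAdd (χ : Character G) (T : Finset G) (hT : ∀ g ∈ T, 0 < (χ g).toAdd) :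
    ∃ δ > 0, ∀ g ∈ T, δ ≤ (χ g).toAdd := by
  obtain rfl | hne := T.eq_empty_or_nonempty
  · exact ⟨1, one_pos, fun _ hg => (Finset.notMem_empty _ hg).elim⟩
  · obtain ⟨g, hg, hmin⟩ := T.exists_min_image (fun g => (χ g).toAdd) hne
    exact ⟨_, hT g hg, hmin⟩

theorem iterate_mem_supportedAbove_of_matrix {χ : Character G} {t δ : ℝ} {n : ℕ} {x : Fin n → P}
    {c : Fin n → Fin n → MonoidAlgebra R G} (hc : ∀ a, ε (x a) = ∑ b, c a b • x b)
    (hδ : ∀ a b, ∀ g ∈ (c a b).coeff.support, δ ≤ (χ g).toAdd)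
    (ht : ∀ a, F (x a) ∈ supportedAbove A χ t) (k : ℕ) (a : Fin n) :
    F ((ε ^ k) (x a)) ∈ supportedAbove A χ (t + k * δ) := by
  induction k generalizing a with
  | zero =>
    simpa only [pow_zero, Module.End.one_apply, Nat.cast_zero, zero_mul, add_zero] using ht a
  | succ k ih =>
    rw [pow_succ, Module.End.mul_apply, hc, map_sum, map_sum]
    refine sum_mem fun b _ => ?_
    rw [map_smul, map_smul, Nat.cast_succ, add_one_mul, ← add_assoc]
    exact smul_mem_supportedAbove (hδ a b) (ih b)

namespace IsSupportedIn

variable {T : Finset G} {χ : Character G}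

theorem exists_iterate_mem_supportedAbove (hε : IsSupportedIn T ε) (hT : ∀ g ∈ T, 0 < (χ g).toAdd)
    (hF : ∀ p, F p ∈ boundedBelow R A χ) :
    ∃ δ > 0, ∀ p, ∃ t, ∀ k : ℕ, F ((ε ^ k) p) ∈ supportedAbove A χ (t + k * δ) := by
  obtain ⟨n, x, c, hx, hc, hcT⟩ := hε
  obtain ⟨δ, hδ, hδT⟩ := exists_pos_le_toAdd χ T hT
  refine ⟨δ, hδ, fun p => ?_⟩
  have hp : p ∈ Submodule.span (MonoidAlgebra R G) (Set.range x) := hx ▸ Submodule.mem_top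
  induction hp using Submodule.span_induction with
  | mem p hp =>
    obtain ⟨a, rfl⟩ := hp
    choose τ hτ using fun a => hF (x a)
    obtain ⟨t, ht⟩ := (Set.finite_range τ).bddBelow
    exact ⟨t, fun k => iterate_mem_supportedAbove_of_matrix hc (fun a b g hg => hδT g (hcT a b hg))
      (fun a => supportedAbove_mono (ht ⟨a, rfl⟩) (hτ a)) k a⟩
  | zero => exact ⟨0, fun k => by simp only [map_zero, zero_mem]⟩
  | add p q _ _ hp hq =>
    obtain ⟨t₁, h₁⟩ := hp
    obtain ⟨t₂, h₂⟩ := hq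
    refine ⟨min t₁ t₂, fun k => ?_⟩
    rw [map_add, map_add]
    exact add_mem (supportedAbove_mono (by gcongr; exact min_le_left _ _) (h₁ k))
      (supportedAbove_mono (by gcongr; exact min_le_right _ _) (h₂ k))
  | smul r p _ hp =>
    obtain ⟨t, ht⟩ := hp
    obtain ⟨e, he⟩ := exists_le_toAdd χ r.coeff.support
    refine ⟨t + e, fun k => ?_⟩
    rw [map_smul, map_smul, add_right_comm]
    exact smul_mem_supportedAbove he (ht k)

theorem eventually_iterate_mem_supportedAbove (hε : IsSupportedIn T ε)
    (hT : ∀ g ∈ T, 0 < (χ g).toAdd) (hF : ∀ p, F p ∈ boundedBelow R A χ) (p : P) (B : ℝ) :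
    ∀ᶠ k in atTop, F ((ε ^ k) p) ∈ supportedAbove A χ B := by
  obtain ⟨δ, hδ, h⟩ := hε.exists_iterate_mem_supportedAbove hT hF
  obtain ⟨t, ht⟩ := h p
  have hlim : Tendsto (fun k : ℕ => t + k * δ) atTop atTop :=
    tendsto_atTop_add_const_left _ _ (tendsto_natCast_atTop_atTop.atTop_mul_const hδ)
  filter_upwards [hlim.eventually_ge_atTop B] with k hk
  exact supportedAbove_mono hk (ht k)

theorem isLocallyFiniteSeries (hε : IsSupportedIn T ε) (hT : ∀ g ∈ T, 0 < (χ g).toAdd)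
    (hF : ∀ p, F p ∈ boundedBelow R A χ) : IsLocallyFiniteSeries F ε := fun p h => by
  filter_upwards [hε.eventually_iterate_mem_supportedAbove hT hF p ((χ h).toAdd + 1)] with k hk
  exact apply_eq_zero_of_lt hk (lt_add_one _)

theorem neumannSum_mem_boundedBelow (hε : IsSupportedIn T ε) (hT : ∀ g ∈ T, 0 < (χ g).toAdd)
    (hF : ∀ p, F p ∈ boundedBelow R A χ) (hs : IsLocallyFiniteSeries F ε) (p : P) :
    neumannSum hs p ∈ boundedBelow R A χ := by
  obtain ⟨K, hK⟩ := eventually_atTop.1 (hε.eventually_iterate_mem_supportedAbove hT hF p 0)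
  rw [← sub_add_cancel (neumannSum hs p) (∑ k ∈ Finset.range K, F ((ε ^ k) p))]
  exact add_mem ⟨0, neumannSum_sub_sum_mem_supportedAbove hs hK⟩ (sum_mem fun k _ => hF _)

theorem neumannSum_mem_novikovSubmodule (hε : IsSupportedIn T ε) (hT : ∀ g ∈ T, 0 < (χ g).toAdd)
    (hF : ∀ p, F p ∈ novikovSubmodule R A χ) (hs : IsLocallyFiniteSeries F ε) (p : P) :
    neumannSum hs p ∈ novikovSubmodule R A χ := by
  intro t
  obtain ⟨K, hK⟩ := eventually_atTop.1 (hε.eventually_iterate_mem_supportedAbove hT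
    (fun p => novikovSubmodule_le_boundedBelow χ (hF p)) p (t + 1))
  have hsum : ∑ k ∈ Finset.range K, F ((ε ^ k) p) ∈ novikovSubmodule R A χ :=
    sum_mem fun k _ => hF _
  refine (hsum t).subset fun h ⟨hh, hht⟩ => ⟨fun h0 => hh ?_, hht⟩
  have htail := apply_eq_zero_of_lt (neumannSum_sub_sum_mem_supportedAbove hs hK)
    (hht.trans_lt (lt_add_one t))
  rwa [sub_apply, h0, sub_zero] at htail

end IsSupportedIn

end Neumann

/-! ### Approximate contractions -/

section Truncation

open Filter

variable {R : Type u} {G : Type v} [Ring R] [Group G] {χ : Character G}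

theorem exists_ofAlgebra_sub_mem_supportedAbove {F : TranslationModule G R}
    (hF : F ∈ novikovSubmodule R R χ) (L : ℝ) :
    ∃ x : MonoidAlgebra R G, ofAlgebra R G x - F ∈ supportedAbove R χ L := by
  classical
  refine ⟨.ofCoeff (Finsupp.onFinset (hF L).toFinset
    (fun g => if (χ g).toAdd ≤ L then F g else 0) fun g hg => ?_), fun h hh => ?_⟩
  · rw [ite_ne_right_iff] at hg
    exact (hF L).mem_toFinset.2 hg.symm
  · by_contra hlt
    refine hh ?_
    rw [sub_apply, ofAlgebra_apply, MonoidAlgebra.coeff_ofCoeff, Finsupp.onFinset_apply,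
      if_pos (not_le.1 hlt).le, sub_self]

theorem eventually_sum_smul_mem_supportedAbove {ι : Type*} {A : Type w'} [AddCommGroup A]
    [Module R A] {F : ℝ → ι → TranslationModule G A}
    (hF : ∀ L i, F L i ∈ supportedAbove A χ L) (c : ι →₀ MonoidAlgebra R G) (t : ℝ) :
    ∀ᶠ L in atTop, (c.sum fun i a => a • F L i) ∈ supportedAbove A χ t := by
  have hterm : ∀ i ∈ c.support, ∀ᶠ L in atTop, c i • F L i ∈ supportedAbove A χ t := by
    intro i _
    obtain ⟨δ, hδ⟩ := exists_le_toAdd χ (c i).coeff.support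
    filter_upwards [eventually_ge_atTop (t - δ)] with L hL
    exact supportedAbove_mono (sub_le_iff_le_add.1 hL) (smul_mem_supportedAbove hδ (hF L i))
  filter_upwards [(eventually_all_finset _).2 hterm] with L hL
  exact sum_mem hL

theorem exists_linearMap_truncation {P : Type w} [AddCommGroup P] [Module (MonoidAlgebra R G) P]
    [Module.Projective (MonoidAlgebra R G) P]
    {t : P →ₗ[MonoidAlgebra R G] TranslationModule G R}
    (ht : ∀ p, t p ∈ novikovSubmodule R R χ) {ι : Type*} [Finite ι] (y : ι → P) (B : ℝ) :
    ∃ t' : P →ₗ[MonoidAlgebra R G] MonoidAlgebra R G,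
      ∀ a, ofAlgebra R G (t' (y a)) - t (y a) ∈ supportedAbove R χ B := by
  obtain ⟨σ, hσ⟩ := Module.projective_def.1 ‹Module.Projective (MonoidAlgebra R G) P›
  choose low hlow using fun (L : ℝ) p => exists_ofAlgebra_sub_mem_supportedAbove (ht p) L
  have herror : ∀ L q, ofAlgebra R G (Finsupp.linearCombination _ (low L) (σ q)) - t q =
      (σ q).sum fun p c => c • (ofAlgebra R G (low L p) - t p) := by
    intro L q
    nth_rw 2 [← hσ q]
    simp only [Finsupp.linearCombination_apply, map_finsuppSum, map_smul, smul_sub, id_eq,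
      Finsupp.sum_sub]
  obtain ⟨L, hL⟩ := (eventually_all.2 fun a =>
    eventually_sum_smul_mem_supportedAbove hlow (σ (y a)) B).exists
  exact ⟨Finsupp.linearCombination _ (low L) ∘ₗ σ, fun a => (herror L (y a)).symm ▸ hL a⟩

end Truncation

theorem exists_dualBasis (B : Type u) (P : Type w) [Ring B] [AddCommGroup P] [Module B P]
    [Module.Finite B P] [Module.Projective B P] :
    ∃ (n : ℕ) (x : Fin n → P) (ξ : Fin n → P →ₗ[B] B), ∀ p, ∑ a, ξ a p • x a = p := by
  obtain ⟨n, π, hπ⟩ := Module.Finite.exists_fin' B P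
  obtain ⟨ι, hι⟩ := Module.projective_lifting_property π LinearMap.id hπ
  refine ⟨n, fun a => π (Pi.single a 1), fun a => LinearMap.proj a ∘ₗ ι, fun p => ?_⟩
  calc ∑ a, ι p a • π (Pi.single a 1) = π (∑ a, ι p a • Pi.single a 1) := by
        simp only [map_sum, map_smul]
    _ = π (ι p) := by rw [← pi_eq_sum_univ' (ι p)]
    _ = p := LinearMap.congr_fun hι p

section HomotopyDefect

variable {B : Type u} [Ring B] {C : ChainComplex (ModuleCat.{w} B) ℤ} {i j k : ℤ}

/-- The difference between the identity and the null-homotopic endomorphism determined by a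
homotopy with components `s` and `s'`. -/
def homotopyDefect (s : C.X i →ₗ[B] C.X j) (s' : C.X k →ₗ[B] C.X i) : C.X i →ₗ[B] C.X i :=
  LinearMap.id - (C.d j i).hom ∘ₗ s - s' ∘ₗ (C.d i k).hom

theorem homotopyDefect_apply (s : C.X i →ₗ[B] C.X j) (s' : C.X k →ₗ[B] C.X i) (x : C.X i) :
    homotopyDefect s s' x = x - (C.d j i).hom (s x) - s' ((C.d i k).hom x) := rfl

theorem homotopyDefect_apply_d (s : C.X i →ₗ[B] C.X j) (s' : C.X k →ₗ[B] C.X i) (y : C.X j) :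
    homotopyDefect s s' ((C.d j i).hom y) = (C.d j i).hom (y - s ((C.d j i).hom y)) := by
  rw [homotopyDefect_apply, d_apply_d, map_zero, sub_zero, map_sub]

theorem apply_homotopyDefect_pow_apply_d {M : Type*} [AddCommGroup M] [Module B M]
    {F : C.X i →ₗ[B] M} (hF : F ∘ₗ (C.d j i).hom = 0) (s : C.X i →ₗ[B] C.X j)
    (s' : C.X k →ₗ[B] C.X i) (n : ℕ) (y : C.X j) :
    F ((homotopyDefect s s' ^ n) ((C.d j i).hom y)) = 0 := by
  induction n generalizing y with
  | zero => exact LinearMap.congr_fun hF y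
  | succ n ih => rw [pow_succ, Module.End.mul_apply, homotopyDefect_apply_d, ih]

theorem exists_homotopyDefect_eq_zero [∀ i, Module.Projective B (C.X i)]
    (h : CohomologyVanishes C (C.X i ⧸ LinearMap.range (C.d (i + 1) i).hom) i) :
    ∃ (s : C.X i →ₗ[B] C.X (i + 1)) (s' : C.X (i - 1) →ₗ[B] C.X i), homotopyDefect s s' = 0 := by
  let q := (LinearMap.range (C.d (i + 1) i).hom).mkQ
  obtain ⟨k, hk⟩ := h q (LinearMap.range_mkQ_comp _)
  obtain ⟨s', hs'⟩ := Module.projective_lifting_property q k (Submodule.mkQ_surjective _)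
  have hrange : ∀ x, x - s' ((C.d i (i - 1)).hom x) ∈ LinearMap.range (C.d (i + 1) i).hom := by
    intro x
    rw [← Submodule.Quotient.mk_eq_zero, Submodule.Quotient.mk_sub, sub_eq_zero]
    exact (LinearMap.congr_fun hk x).symm.trans (LinearMap.congr_fun hs' _).symm
  obtain ⟨s, hs⟩ := Module.projective_lifting_property (C.d (i + 1) i).hom.rangeRestrict
    ((LinearMap.id - s' ∘ₗ (C.d i (i - 1)).hom).codRestrict _ hrange)
    (LinearMap.surjective_rangeRestrict _)
  refine ⟨s, s', LinearMap.ext fun x => ?_⟩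
  have hsx : (C.d (i + 1) i).hom (s x) = x - s' ((C.d i (i - 1)).hom x) :=
    congrArg Subtype.val (LinearMap.congr_fun hs x)
  rw [homotopyDefect_apply, hsx, sub_sub_cancel, sub_self, LinearMap.zero_apply]

end HomotopyDefect

section ApproxContraction

open Filter

variable {R : Type u} {G : Type v} [Ring R] [Group G]
variable {C : ChainComplex (ModuleCat.{w} (MonoidAlgebra R G)) ℤ} {i j k l : ℤ}
variable {T : Finset G} {χ : Character G}

/-- Near degree `i`, the identity of `C` is homotopic to an endomorphism supported in `T`. -/
def HasApproxContraction (C : ChainComplex (ModuleCat.{w} (MonoidAlgebra R G)) ℤ) (T : Finset G)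
    (i : ℤ) : Prop :=
  ∃ (s : C.X i →ₗ[MonoidAlgebra R G] C.X (i + 1)) (s' : C.X (i - 1) →ₗ[MonoidAlgebra R G] C.X i),
    IsSupportedIn T (homotopyDefect s s')

variable {s : C.X j →ₗ[MonoidAlgebra R G] C.X k} {s' : C.X i →ₗ[MonoidAlgebra R G] C.X j}

theorem neumannSum_comp_comp_d {A : Type*} [AddCommGroup A] [Module R A]
    {F : C.X j →ₗ[MonoidAlgebra R G] TranslationModule G A}
    (hs : IsLocallyFiniteSeries F (homotopyDefect s s')) (hF : F ∘ₗ (C.d k j).hom = 0) :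
    (neumannSum hs ∘ₗ s') ∘ₗ (C.d j i).hom = F := by
  refine LinearMap.ext fun x => ?_
  have hd : neumannSum hs ((C.d k j).hom (s x)) = 0 :=
    neumannSum_eq_zero hs fun n => apply_homotopyDefect_pow_apply_d hF s s' n (s x)
  rw [← neumannSum_sub_neumannSum_apply hs x, homotopyDefect_apply, map_sub, map_sub, hd, sub_zero,
    sub_sub_cancel]
  rfl

theorem exists_novikov_primitive (hj : j = i + 1) (hl : l = i - 1)
    (hs : IsSupportedIn T (homotopyDefect s s')) (hT : ∀ g ∈ T, 0 < (χ g).toAdd)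
    (hv : CohomologyVanishes C (novikovSubmodule R R χ) i)
    {ξ : C.X i →ₗ[MonoidAlgebra R G] MonoidAlgebra R G}
    (hF : IsLocallyFiniteSeries (ofAlgebra R G ∘ₗ ξ ∘ₗ (C.d j i).hom) (homotopyDefect s s')) :
    ∃ t : C.X l →ₗ[MonoidAlgebra R G] TranslationModule G R,
      (∀ p, t p ∈ novikovSubmodule R R χ) ∧
      t ∘ₗ (C.d i l).hom = ofAlgebra R G ∘ₗ ξ - neumannSum hF ∘ₗ s' := by
  have hmem : ∀ p, (ofAlgebra R G ∘ₗ ξ - neumannSum hF ∘ₗ s') p ∈ novikovSubmodule R R χ :=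
    fun p => sub_mem (ofAlgebra_mem_novikovSubmodule χ _)
      (hs.neumannSum_mem_novikovSubmodule hT (fun p => ofAlgebra_mem_novikovSubmodule χ _) hF _)
  have hcocycle : (ofAlgebra R G ∘ₗ ξ - neumannSum hF ∘ₗ s') ∘ₗ (C.d j i).hom = 0 := by
    rw [LinearMap.sub_comp, neumannSum_comp_comp_d hF, LinearMap.comp_assoc, sub_self]
    rw [LinearMap.comp_assoc, LinearMap.comp_assoc, d_hom_comp_d_hom, LinearMap.comp_zero,
      LinearMap.comp_zero]
  obtain ⟨t, ht⟩ := hv.exists_primitive hj hl (LinearMap.codRestrict _ _ hmem)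
    (LinearMap.ext fun x => Subtype.ext (LinearMap.congr_fun hcocycle x))
  exact ⟨(novikovSubmodule R R χ).subtype ∘ₗ t, fun p => (t p).2,
    LinearMap.ext fun x => congrArg Subtype.val (LinearMap.congr_fun ht x)⟩

theorem eventually_sub_mem_supportedAbove_one [Module.Projective (MonoidAlgebra R G) (C.X l)]
    (hj : j = i + 1) (hl : l = i - 1)
    (hs : IsSupportedIn T (homotopyDefect s s')) (hT : ∀ g ∈ T, 0 < (χ g).toAdd)
    (hv : CohomologyVanishes C (novikovSubmodule R R χ) i)
    (ξ : C.X i →ₗ[MonoidAlgebra R G] MonoidAlgebra R G) {ι : Type*} [Finite ι] (y : ι → C.X i) :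
    ∃ t : C.X l →ₗ[MonoidAlgebra R G] MonoidAlgebra R G, ∀ᶠ K in atTop, ∀ b,
      ofAlgebra R G (ξ (homotopyDefect
        ((∑ n ∈ Finset.range K, homotopyDefect s s' ^ n) ∘ₗ s') (0 : C.X l →ₗ[_] C.X i) (y b)) -
          t ((C.d i l).hom (y b))) ∈ supportedAbove R χ 1 := by
  have hF : ∀ p, (ofAlgebra R G ∘ₗ ξ ∘ₗ (C.d j i).hom) p ∈ boundedBelow R R χ := fun p =>
    novikovSubmodule_le_boundedBelow χ (ofAlgebra_mem_novikovSubmodule χ _)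
  have hloc := hs.isLocallyFiniteSeries hT hF
  obtain ⟨t, ht, htd⟩ := exists_novikov_primitive hj hl hs hT hv hloc
  obtain ⟨t', ht'⟩ := exists_linearMap_truncation ht (fun b => (C.d i l).hom (y b)) 1
  refine ⟨t', ?_⟩
  have hiter : ∀ᶠ K in atTop, ∀ b, ∀ n ≥ K, ofAlgebra R G (ξ ((C.d j i).hom
      ((homotopyDefect s s' ^ n) (s' (y b))))) ∈ supportedAbove R χ 1 :=
    eventually_all.2 fun b =>
      eventually_forall_ge_atTop.2 (hs.eventually_iterate_mem_supportedAbove hT hF (s' (y b)) 1)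
  filter_upwards [hiter] with K hK b
  have htail := neumannSum_sub_sum_mem_supportedAbove hloc (hK b)
  convert sub_mem htail (ht' b) using 1
  have htb : t ((C.d i l).hom (y b)) = ofAlgebra R G (ξ (y b)) - neumannSum hloc (s' (y b)) :=
    LinearMap.congr_fun htd (y b)
  simp only [htb, homotopyDefect_apply, LinearMap.comp_apply, LinearMap.sum_apply,
    LinearMap.zero_apply, map_sub, map_sum, map_zero]
  abel

theorem HasApproxContraction.exists_isSupportedIn (h : HasApproxContraction C T j)
    (hi : i = j - 1) (hk : k = j + 1) : ∃ (s : C.X j →ₗ[MonoidAlgebra R G] C.X k)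
      (s' : C.X i →ₗ[MonoidAlgebra R G] C.X j), IsSupportedIn T (homotopyDefect s s') := by
  subst hi hk
  exact h

theorem HasApproxContraction.exists_of_add_one [∀ i, Module.Projective (MonoidAlgebra R G) (C.X i)]
    [Module.Finite (MonoidAlgebra R G) (C.X i)] (h : HasApproxContraction C T (i + 1))
    (hT : ∀ g ∈ T, 0 < (χ g).toAdd) (hv : CohomologyVanishes C (novikovSubmodule R R χ) i) :
    ∃ T' : Finset G, (∀ g ∈ T', 0 < (χ g).toAdd) ∧ HasApproxContraction C T' i := by
  classical
  obtain ⟨s, s', hs⟩ := h.exists_isSupportedIn (add_sub_cancel_right i 1).symm rfl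
  obtain ⟨n, x, ξ, hx⟩ := exists_dualBasis (MonoidAlgebra R G) (C.X i)
  choose t ht using fun a => eventually_sub_mem_supportedAbove_one rfl rfl hs hT hv (ξ a) x
  obtain ⟨K, hK⟩ := (eventually_all.2 ht).exists
  let σ := (∑ n ∈ Finset.range K, homotopyDefect s s' ^ n) ∘ₗ s'
  let τ : C.X (i - 1) →ₗ[MonoidAlgebra R G] C.X i := ∑ a, (t a).smulRight (x a)
  let c : Fin n → Fin n → MonoidAlgebra R G := fun b a =>
    ξ a (homotopyDefect σ (0 : C.X (i - 1) →ₗ[_] C.X i) (x b)) -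
      t a ((C.d i (i - 1)).hom (x b))
  have hc : ∀ b a, ∀ g ∈ (c b a).coeff.support, 1 ≤ (χ g).toAdd := fun b a g hg =>
    hK a b g (Finsupp.mem_support_iff.1 hg)
  refine ⟨Finset.univ.biUnion fun ba : Fin n × Fin n => (c ba.1 ba.2).coeff.support,
    fun g hg => ?_, σ, τ, n, x, c, ?_, fun b => ?_, fun b a => ?_⟩
  · obtain ⟨ba, -, hg⟩ := Finset.mem_biUnion.1 hg
    exact one_pos.trans_le (hc ba.1 ba.2 g hg)
  · refine eq_top_iff.2 fun p _ => ?_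
    rw [← hx p]
    exact sum_mem fun a _ => Submodule.smul_mem _ _ (Submodule.subset_span ⟨a, rfl⟩)
  · simp only [c, sub_smul, Finset.sum_sub_distrib, hx]
    simp only [homotopyDefect_apply, LinearMap.zero_apply, sub_zero, τ, LinearMap.sum_apply,
      LinearMap.smulRight_apply]
  · exact fun g hg => Finset.mem_biUnion.2 ⟨(b, a), Finset.mem_univ _, hg⟩

variable [∀ i, Module.Projective (MonoidAlgebra R G) (C.X i)]

theorem hasApproxContraction_empty [Module.Finite (MonoidAlgebra R G) (C.X i)]
    (h : CohomologyVanishes C (C.X i ⧸ LinearMap.range (C.d (i + 1) i).hom) i) :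
    HasApproxContraction C (∅ : Finset G) i := by
  obtain ⟨s, s', hs⟩ := exists_homotopyDefect_eq_zero h
  obtain ⟨n, x, hx⟩ := Module.Finite.exists_fin (R := MonoidAlgebra R G) (M := C.X i)
  refine ⟨s, s', n, x, 0, hx, fun a => ?_, fun _ _ => ?_⟩
  · simp only [hs, LinearMap.zero_apply, Pi.zero_apply, zero_smul, Finset.sum_const_zero]
  · exact Finsupp.support_zero.subset

theorem exists_hasApproxContraction {m n : ℤ}
    (hfin : ∀ i, m < i → Module.Finite (MonoidAlgebra R G) (C.X i))
    (hcd : complexCd C ≤ ((n : WithTop ℤ) : WithBot (WithTop ℤ)))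
    (hv : ∀ i, m < i → CohomologyVanishes C (novikovSubmodule R R χ) i) (hi : m < i) :
    ∃ T : Finset G, (∀ g ∈ T, 0 < (χ g).toAdd) ∧ HasApproxContraction C T i := by
  have hdown : ∀ j ≤ max (n + 1) i, m < j →
      ∃ T : Finset G, (∀ g ∈ T, 0 < (χ g).toAdd) ∧ HasApproxContraction C T j := by
    intro j hj
    induction j, hj using Int.leInductionDown with
    | base =>
      intro hm
      have := hfin _ hm
      exact ⟨∅, fun g hg => (Finset.notMem_empty g hg).elim, hasApproxContraction_empty
        (complexCd_le_iff.1 hcd _ (lt_max_of_lt_left (lt_add_one n)) (ModuleCat.of _ _))⟩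
    | pred j _ ih =>
      intro hm
      obtain ⟨T, hT, hC⟩ := ih (hm.trans (sub_one_lt j))
      have := hfin _ hm
      exact HasApproxContraction.exists_of_add_one ((sub_add_cancel j 1).symm ▸ hC) hT (hv _ hm)
  exact hdown i (le_max_right _ _) hi

end ApproxContraction

/-! ### Coinduced modules and cones of characters -/

section Cone

open Filter

variable {R : Type u} {G : Type v} [Ring R] [Group G] {N : Subgroup G}
variable {A : Type w'} [AddCommGroup A] [Module R A] [DistribMulAction N A] [SMulCommClass R N A]

variable (R N A) in
/-- The `R[G]`-module coinduced from the `R[N]`-module `A`. -/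
def coinduced : Submodule (MonoidAlgebra R G) (TranslationModule G A) where
  carrier := {F | ∀ (x : N) (h : G), F (h * x) = x⁻¹ • F h}
  zero_mem' x _ := (smul_zero x⁻¹).symm
  add_mem' hF hF' x h := by rw [add_apply, add_apply, hF x h, hF' x h, smul_add]
  smul_mem' c F hF x h := by
    rw [smul_apply_eq_sum, smul_apply_eq_sum, Finsupp.smul_sum]
    refine Finsupp.sum_congr fun g _ => ?_
    rw [← mul_assoc, hF x (g⁻¹ * h), smul_comm]

variable (R N A) in
/-- The elements of the coinduced module with support bounded below with respect to all characters
in `J`. -/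
def coneModule (J : Set (Character G)) : Submodule (MonoidAlgebra R G) (TranslationModule G A) :=
  coinduced R N A ⊓ ⨅ χ ∈ J, boundedBelow R A χ

variable {F : TranslationModule G A} {J : Set (Character G)} {a b c χ : Character G} {s : Set G}

theorem mem_coneModule :
    F ∈ coneModule R N A J ↔ F ∈ coinduced R N A ∧ ∀ χ ∈ J, F ∈ boundedBelow R A χ := by
  simp only [coneModule, Submodule.mem_inf, Submodule.mem_iInf]

theorem mem_coneModule_insert :
    F ∈ coneModule R N A (insert χ J) ↔ F ∈ boundedBelow R A χ ∧ F ∈ coneModule R N A J := by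
  rw [mem_coneModule, Set.forall_mem_insert, and_left_comm, mem_coneModule]

theorem coneModule_empty : coneModule R N A ∅ = coinduced R N A := by
  ext F
  simp only [mem_coneModule, Set.mem_empty_iff_false, false_imp_iff, implies_true, and_true]

theorem coneModule_insert_one (J : Set (Character G)) :
    coneModule R N A (insert 1 J) = coneModule R N A J := by
  ext F
  exact mem_coneModule_insert.trans (and_iff_right ⟨0, fun _ _ => le_rfl⟩)

theorem toAdd_add_toAdd_of_mul_eq_sq (hc : a * b = c ^ 2) (g : G) :
    (a g).toAdd + (b g).toAdd = 2 * (c g).toAdd := by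
  have h := congrArg Multiplicative.toAdd (DFunLike.congr_fun hc g)
  rwa [MonoidHom.mul_apply, MonoidHom.pow_apply, toAdd_mul, toAdd_pow, two_nsmul, ← two_mul] at h

theorem boundedBelow_inf_le (hc : a * b = c ^ 2) :
    boundedBelow R A a ⊓ boundedBelow R A b ≤ boundedBelow R A c := by
  rintro F ⟨⟨s, hs⟩, ⟨t, ht⟩⟩
  refine ⟨(s + t) / 2, fun g hg => ?_⟩
  linarith [hs g hg, ht g hg, toAdd_add_toAdd_of_mul_eq_sq hc g]

theorem coneModule_inf (hc : a * b = c ^ 2) (J : Set (Character G)) :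
    coneModule R N A (insert a (insert c J)) ⊓ coneModule R N A (insert b (insert c J)) =
      coneModule R N A (insert a (insert b J)) := by
  ext F
  simp only [Submodule.mem_inf, mem_coneModule_insert]
  exact ⟨fun ⟨⟨ha, _, hJ⟩, hb, _⟩ => ⟨ha, hb, hJ⟩, fun ⟨ha, hb, hJ⟩ =>
    have hFc := boundedBelow_inf_le hc ⟨ha, hb⟩
    ⟨⟨ha, hFc, hJ⟩, hb, hFc, hJ⟩⟩

/-- The function which agrees with `F` on `s` and vanishes elsewhere. -/
def restrictTo (s : Set G) (F : TranslationModule G A) : TranslationModule G A := ⟨s.indicator F⟩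

theorem restrictTo_mem_boundedBelow (hs : ∀ g ∈ s, (c g).toAdd ≤ (χ g).toAdd)
    (hF : F ∈ boundedBelow R A c) : restrictTo s F ∈ boundedBelow R A χ := by
  obtain ⟨t, ht⟩ := hF
  refine ⟨t, fun g hg => ?_⟩
  have hgs := Set.mem_of_indicator_ne_zero hg
  exact (ht g fun h0 => hg ((Set.indicator_of_mem hgs F).trans h0)).trans (hs g hgs)

theorem restrictTo_mem_coinduced (hs : ∀ (x : N) (g : G), g * x ∈ s ↔ g ∈ s)
    (hF : F ∈ coinduced R N A) : restrictTo s F ∈ coinduced R N A := by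
  intro x h
  change s.indicator F (h * x) = x⁻¹ • s.indicator F h
  by_cases hh : h ∈ s
  · rw [Set.indicator_of_mem hh, Set.indicator_of_mem ((hs x h).2 hh), hF x h]
  · rw [Set.indicator_of_notMem hh, Set.indicator_of_notMem (mt (hs x h).1 hh), smul_zero]

theorem restrictTo_mem_coneModule (hs : ∀ (x : N) (g : G), g * x ∈ s ↔ g ∈ s)
    (hF : F ∈ coneModule R N A J) : restrictTo s F ∈ coneModule R N A J :=
  mem_coneModule.2 ⟨restrictTo_mem_coinduced hs (mem_coneModule.1 hF).1, fun χ hχ =>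
    restrictTo_mem_boundedBelow (fun _ _ => le_rfl) ((mem_coneModule.1 hF).2 χ hχ)⟩

theorem coneModule_sup (hc : a * b = c ^ 2) (ha : ∀ x ∈ N, a x = 1) (hb : ∀ x ∈ N, b x = 1)
    (J : Set (Character G)) :
    coneModule R N A (insert a (insert c J)) ⊔ coneModule R N A (insert b (insert c J)) =
      coneModule R N A (insert c J) := by
  refine le_antisymm (sup_le (fun F hF => (mem_coneModule_insert.1 hF).2)
    fun F hF => (mem_coneModule_insert.1 hF).2) fun F hF => ?_
  have hmid := toAdd_add_toAdd_of_mul_eq_sq hc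
  let s : Set G := {g | (b g).toAdd ≤ (a g).toAdd}
  have hs : ∀ (x : N) (g : G), g * x ∈ s ↔ g ∈ s := fun x g => by
    simp only [s, Set.mem_ofPred_eq, map_mul, ha x x.2, hb x x.2, mul_one]
  have hFc := (mem_coneModule_insert.1 hF).1
  refine Submodule.mem_sup.2 ⟨restrictTo s F, mem_coneModule_insert.2
      ⟨restrictTo_mem_boundedBelow (fun g hg => ?_) hFc, restrictTo_mem_coneModule hs hF⟩,
    restrictTo sᶜ F, mem_coneModule_insert.2 ⟨restrictTo_mem_boundedBelow (fun g hg => ?_) hFc,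
      restrictTo_mem_coneModule (fun x g => not_congr (hs x g)) hF⟩,
    ext fun g => Set.indicator_self_add_compl_apply s F g⟩
  · linarith [hmid g, show (b g).toAdd ≤ (a g).toAdd from hg]
  · linarith [hmid g, not_le.1 (show ¬(b g).toAdd ≤ (a g).toAdd from hg)]

theorem neumannSum_mem_coinduced {P : Type w} [AddCommGroup P] [Module (MonoidAlgebra R G) P]
    {F : P →ₗ[MonoidAlgebra R G] TranslationModule G A} {ε : P →ₗ[MonoidAlgebra R G] P}
    (hF : ∀ p, F p ∈ coinduced R N A) (hs : IsLocallyFiniteSeries F ε) (p : P) :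
    neumannSum hs p ∈ coinduced R N A := by
  intro x h
  obtain ⟨K, hK, hK'⟩ :=
    ((eventually_neumannSum_apply hs p (h * x)).and (eventually_neumannSum_apply hs p h)).exists
  rw [hK, hK', (sum_mem fun k _ => hF _ : ∑ k ∈ Finset.range K, F ((ε ^ k) p) ∈ _) x h]

theorem HasApproxContraction.cohomologyVanishes_coneModule
    {C : ChainComplex (ModuleCat.{w} (MonoidAlgebra R G)) ℤ} {T : Finset G} {i : ℤ}
    (h : HasApproxContraction C T i) (hJ : J.Nonempty)
    (hT : ∀ χ ∈ J, ∀ g ∈ T, 0 < (χ g).toAdd) : CohomologyVanishes C (coneModule R N A J) i := by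
  intro f hf
  obtain ⟨s, s', hs⟩ := h
  obtain ⟨χ, hχ⟩ := hJ
  let F := (coneModule R N A J).subtype ∘ₗ f
  have hmem : ∀ p, F p ∈ coinduced R N A ∧ ∀ χ ∈ J, F p ∈ boundedBelow R A χ :=
    fun p => mem_coneModule.1 (f p).2
  have hloc := hs.isLocallyFiniteSeries (hT χ hχ) fun p => (hmem p).2 χ hχ
  have hcone : ∀ p, neumannSum hloc p ∈ coneModule R N A J := fun p => mem_coneModule.2
    ⟨neumannSum_mem_coinduced (fun p => (hmem p).1) hloc p, fun χ hχ =>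
      hs.neumannSum_mem_boundedBelow (hT χ hχ) (fun p => (hmem p).2 χ hχ) hloc p⟩
  have hF : F ∘ₗ (C.d (i + 1) i).hom = 0 := by
    rw [LinearMap.comp_assoc, hf, LinearMap.comp_zero]
  exact ⟨LinearMap.codRestrict _ (neumannSum hloc ∘ₗ s') fun p => hcone (s' p),
    LinearMap.ext fun x => Subtype.ext (LinearMap.congr_fun (neumannSum_comp_comp_d hloc hF) x)⟩

end Cone

/-! ### Subdivision of simplices -/

section Subdivision

variable {E : Type*} [NormedAddCommGroup E] {J J₁ : Finset E} {a b q x : E} {D L : ℝ}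
variable {V : ℤ → Finset E → Prop} {m : ℤ} {K : Set E}

/-- The ordered pairs of points of `J` at distance more than `D`. -/
def longPairs (D : ℝ) (J : Finset E) : Finset (E × E) :=
  (J ×ˢ J).filter fun p => D < dist p.1 p.2

theorem mem_longPairs {p : E × E} :
    p ∈ longPairs D J ↔ (p.1 ∈ J ∧ p.2 ∈ J) ∧ D < dist p.1 p.2 := by
  rw [longPairs, Finset.mem_filter, Finset.mem_product]

theorem longPairs_ssubset [DecidableEq E] (ha : a ∈ J) (hb : b ∈ J) (hab : D < dist a b)
    (hq : ∀ x ∈ J, dist q x ≤ D) (hJ : J₁ ⊆ insert q J) (h : a ∉ J₁ ∨ b ∉ J₁) :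
    longPairs D J₁ ⊂ longPairs D J := by
  have hq' : ∀ x ∈ J₁, dist q x ≤ D := fun x hx => by
    rcases Finset.mem_insert.1 (hJ hx) with rfl | hx
    · exact (dist_self x).trans_le (dist_nonneg.trans (hq a ha))
    · exact hq x hx
  refine ⟨fun p hp => ?_, fun hsub => ?_⟩
  · obtain ⟨⟨h₁, h₂⟩, hlong⟩ := mem_longPairs.1 hp
    have hne₁ : p.1 ≠ q := fun h => hlong.not_ge (h ▸ hq' _ h₂)
    have hne₂ : p.2 ≠ q := fun h => hlong.not_ge (dist_comm p.1 p.2 ▸ h ▸ hq' _ h₁)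
    exact mem_longPairs.2 ⟨⟨(Finset.mem_insert.1 (hJ h₁)).resolve_left hne₁,
      (Finset.mem_insert.1 (hJ h₂)).resolve_left hne₂⟩, hlong⟩
  · have hmem := (mem_longPairs.1 (hsub (mem_longPairs.2 ⟨⟨ha, hb⟩, hab⟩ : (a, b) ∈ _))).1
    exact h.elim (· hmem.1) (· hmem.2)

/-- `V i J` holds in all degrees `i > m` for all nonempty `J` close to `v`. -/
def HoldsNear (V : ℤ → Finset E → Prop) (m : ℤ) (v : E) : Prop :=
  ∃ U ∈ nhds v, ∀ J : Finset E, J.Nonempty → ↑J ⊆ U → ∀ i, m < i → V i J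

/-- `V i J` holds in all degrees `i ≥ m + #J` for all nonempty `J ⊆ K` of diameter at most `L`. -/
def HoldsUpToDiam (V : ℤ → Finset E → Prop) (m : ℤ) (K : Set E) (L : ℝ) : Prop :=
  ∀ J : Finset E, J.Nonempty → ↑J ⊆ K → (∀ x ∈ J, ∀ y ∈ J, dist x y ≤ L) →
    ∀ i : ℤ, m + J.card ≤ i → V i J

theorem exists_pos_holdsUpToDiam (hK : IsCompact K) (hV : ∀ v ∈ K, HoldsNear V m v) :
    ∃ δ > 0, HoldsUpToDiam V m K δ := by
  choose! U hU hUV using hV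
  obtain ⟨W, hW, h⟩ := lebesgue_number_lemma_nhds' (U := fun v _ => U v) hK hU
  obtain ⟨δ, hδ, hδW⟩ := Metric.uniformity_basis_dist_le.mem_iff.1 hW
  refine ⟨δ, hδ, fun J hJ hJK hJδ i hi => ?_⟩
  obtain ⟨x, hx⟩ := hJ
  obtain ⟨v, hv⟩ := h x (hJK hx)
  have := Finset.card_pos.2 ⟨x, hx⟩
  exact hUV v v.2 J ⟨x, hx⟩ (fun y hy => hv (hδW (hJδ x hx y hy))) i (by omega)

theorem exists_insert_insert_eq {α : Type*} [DecidableEq α] {s : Finset α} {a b : α} (ha : a ∈ s)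
    (hb : b ∈ s) : ∃ t, a ∉ t ∧ b ∉ t ∧ insert a (insert b t) = s :=
  ⟨(s.erase a).erase b, by grind, by grind, by grind⟩

/-- The vectors `± e l` with `l ∈ L`. -/
def signedVectors {α ι : Type*} [DecidableEq α] [Neg α] (e : ι → α) (L : Finset ι) : Finset α :=
  L.image e ∪ L.image fun l => -e l

theorem signedVectors_insert {α ι : Type*} [DecidableEq α] [Neg α] [DecidableEq ι] (e : ι → α)
    (l : ι) (L : Finset ι) :
    signedVectors e (insert l L) = insert (e l) (insert (-e l) (signedVectors e L)) := by
  rw [signedVectors, signedVectors, Finset.image_insert, Finset.image_insert, Finset.insert_union,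
    Finset.union_insert]

variable [InnerProductSpace ℝ E]

theorem dist_midpoint_le (hab : 9 / 10 * L ≤ dist a b) (ha : dist a x ≤ L) (hb : dist b x ≤ L) :
    dist (midpoint ℝ a b) x ≤ 9 / 10 * L := by
  have hL : 0 ≤ L := dist_nonneg.trans ha
  have hmid :=
    EuclideanGeometry.dist_sq_add_dist_sq_eq_two_mul_dist_midpoint_sq_add_half_dist_sq x a b
  rw [dist_comm x a, dist_comm x b, dist_comm x] at hmid
  have ha' : dist a x ^ 2 ≤ L ^ 2 := by gcongr
  have hb' : dist b x ^ 2 ≤ L ^ 2 := by gcongr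
  have hab' : (9 / 10 * L) ^ 2 ≤ dist a b ^ 2 := by gcongr
  refine le_of_sq_le_sq ?_ (by positivity)
  nlinarith

variable [DecidableEq E]

/-- The statements `V i J` about the simplices spanned by finite sets `J` are inherited by a simplex
with an edge `ab` from the two halves into which the midpoint of `ab` divides it and their common
face. The shift in `i` is that of the Mayer–Vietoris sequence. -/
def GluesAtMidpoints (V : ℤ → Finset E → Prop) : Prop :=
  ∀ (i : ℤ) (a b : E) (J : Finset E), V i (insert a (insert (midpoint ℝ a b) J)) →
    V i (insert b (insert (midpoint ℝ a b) J)) → V (i - 1) (insert (midpoint ℝ a b) J) →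
    V i (insert a (insert b J))

/-- The statements `V i J` about the simplices spanned by finite sets `J` are inherited by the
common face of the two halves into which the midpoint of an edge `ab` divides a simplex, from the
halves and the whole simplex. -/
def DescendsToMidpoints (V : ℤ → Finset E → Prop) : Prop :=
  ∀ (i : ℤ) (a b : E) (J : Finset E), V i (insert a (insert (midpoint ℝ a b) J)) →
    V i (insert b (insert (midpoint ℝ a b) J)) → V (i + 1) (insert a (insert b J)) →
    V i (insert (midpoint ℝ a b) J)

theorem GluesAtMidpoints.holdsUpToDiam (hV : GluesAtMidpoints V) (hK : Convex ℝ K)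
    (h : HoldsUpToDiam V m K (9 / 10 * L)) : HoldsUpToDiam V m K L := by
  intro J hJ hJK hJL i hi
  induction hc : longPairs (9 / 10 * L) J using WellFoundedLT.induction generalizing J i with
  | _ P ih =>
  subst hc
  by_cases hs : ∀ x ∈ J, ∀ y ∈ J, dist x y ≤ 9 / 10 * L
  · exact h J hJ hJK hs i hi
  push Not at hs
  obtain ⟨a, ha, b, hb, hab⟩ := hs
  have hL : 0 ≤ L := dist_nonneg.trans (hJL a ha b hb)
  set q := midpoint ℝ a b
  have hq : ∀ x ∈ J, dist q x ≤ 9 / 10 * L := fun x hx =>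
    dist_midpoint_le hab.le (hJL a ha x hx) (hJL b hb x hx)
  have hqL : ∀ x ∈ insert q J, ∀ y ∈ insert q J, dist x y ≤ L := by
    have hqL : ∀ x ∈ J, dist q x ≤ L := fun x hx => (hq x hx).trans (by linarith)
    simp only [Finset.forall_mem_insert, dist_self, dist_comm _ q]
    exact ⟨⟨hL, hqL⟩, fun x hx => ⟨hqL x hx, hJL x hx⟩⟩
  have ih' : ∀ J₁ ⊆ insert q J, J₁.Nonempty → a ∉ J₁ ∨ b ∉ J₁ →
      ∀ i, m + J₁.card ≤ i → V i J₁ := fun J₁ hJ₁ hne hab' i hi =>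
    ih _ (longPairs_ssubset ha hb hab hq hJ₁ hab') J₁ hne
      (fun x hx => (Finset.mem_insert.1 (hJ₁ hx)).elim
        (fun h => h ▸ hK.midpoint_mem (hJK ha) (hJK hb)) (hJK ·))
      (fun x hx y hy => hqL x (hJ₁ hx) y (hJ₁ hy)) i hi rfl
  have hqa : a ≠ q := fun h => hab.not_ge (h ▸ hq b hb)
  have hqb : b ≠ q := fun h => hab.not_ge (dist_comm a b ▸ h ▸ hq a ha)
  have hne : a ≠ b := fun h => hab.not_ge (h ▸ (dist_self a).trans_le (by positivity))
  obtain ⟨J, haJ, hbJ, rfl⟩ := exists_insert_insert_eq ha hb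
  rw [Finset.card_insert_of_notMem (by grind), Finset.card_insert_of_notMem hbJ] at hi
  have hcard := Finset.card_insert_le q J
  have hcard' := fun c => Finset.card_insert_le c (insert q J)
  exact hV i a b J
    (ih' _ (by grind) (Finset.insert_nonempty _ _) (.inr (by grind)) i (by grind))
    (ih' _ (by grind) (Finset.insert_nonempty _ _) (.inl (by grind)) i (by grind))
    (ih' _ (by grind) (Finset.insert_nonempty _ _) (.inl (by grind)) (i - 1) (by grind))

theorem GluesAtMidpoints.of_subset_convex (hV : GluesAtMidpoints V) (hK : Convex ℝ K)
    (hKc : IsCompact K) (hloc : ∀ v ∈ K, HoldsNear V m v) (hJ : J.Nonempty) (hJK : ↑J ⊆ K) {i : ℤ}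
    (hi : m + J.card ≤ i) : V i J := by
  obtain ⟨δ, hδ, h⟩ := exists_pos_holdsUpToDiam hKc hloc
  have hpow : ∀ k : ℕ, HoldsUpToDiam V m K ((10 / 9) ^ k * δ) := fun k => by
    induction k with
    | zero => simpa only [pow_zero, one_mul] using h
    | succ k ih =>
      refine hV.holdsUpToDiam hK ?_
      rwa [pow_succ', ← mul_assoc, ← mul_assoc, show (9 / 10 * (10 / 9) : ℝ) = 1 by norm_num,
        one_mul]
  obtain ⟨C, hC⟩ := Metric.isBounded_iff.1 J.finite_toSet.isBounded
  obtain ⟨k, hk⟩ := pow_unbounded_of_one_lt (C / δ) (by norm_num : (1 : ℝ) < 10 / 9)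
  exact hpow k J hJ hJK (fun x hx y hy => (hC hx hy).trans ((div_lt_iff₀ hδ).1 hk).le) i hi

theorem GluesAtMidpoints.insert_neg (hV : GluesAtMidpoints V)
    (hzero : ∀ i J, V i (insert 0 J) ↔ V i J) {i : ℤ} (h : V i (insert x J))
    (h' : V i (insert (-x) J)) (h'' : V (i - 1) J) : V i (insert x (insert (-x) J)) := by
  refine hV i x (-x) J ?_ ?_ ?_ <;> rw [midpoint_self_neg]
  · rwa [Finset.insert_comm, hzero]
  · rwa [Finset.insert_comm, hzero]
  · rwa [hzero]

theorem DescendsToMidpoints.of_insert_neg (hV : DescendsToMidpoints V)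
    (hzero : ∀ i J, V i (insert 0 J) ↔ V i J) {i : ℤ} (h : V i (insert x J))
    (h' : V i (insert (-x) J)) (h'' : V (i + 1) (insert x (insert (-x) J))) : V i J := by
  refine (hzero i J).1 (midpoint_self_neg ℝ x ▸ hV i x (-x) J ?_ ?_ h'') <;> rw [midpoint_self_neg]
  · rwa [Finset.insert_comm, hzero]
  · rwa [Finset.insert_comm, hzero]

/-- `J` lies in an open half-space bounded by a hyperplane through the origin. -/
def IsPointed (J : Finset E) : Prop :=
  ∃ w : E, ∀ x ∈ J, 1 ≤ inner ℝ w x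

omit [DecidableEq E] in
theorem isPointed_empty : IsPointed (∅ : Finset E) :=
  ⟨0, fun _ hx => absurd hx (Finset.notMem_empty _)⟩

theorem IsPointed.insert (hJ : IsPointed J) (hx : ‖x‖ = 1) (hxJ : ∀ y ∈ J, inner ℝ x y = 0) :
    IsPointed (insert x J) := by
  obtain ⟨w, hw⟩ := hJ
  refine ⟨w + (1 - inner ℝ w x) • x, (Finset.forall_mem_insert _ _ _).2 ⟨?_, fun y hy => ?_⟩⟩
  · rw [inner_add_left, real_inner_smul_left, real_inner_self_eq_norm_sq, hx]
    linarith
  · rw [inner_add_left, real_inner_smul_left, hxJ y hy, mul_zero, add_zero]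
    exact hw y hy

theorem GluesAtMidpoints.of_isPointed [ProperSpace E] (hV : GluesAtMidpoints V)
    (hloc : ∀ v, v ≠ 0 → HoldsNear V m v) (hJ : J.Nonempty) (hJw : IsPointed J) {i : ℤ}
    (hi : m + J.card ≤ i) : V i J := by
  obtain ⟨w, hw⟩ := hJw
  obtain ⟨C, hC⟩ := J.finite_toSet.isBounded.subset_closedBall 0
  have hclosed : IsClosed {x : E | 1 ≤ inner ℝ w x} := isClosed_le (by fun_prop) (by fun_prop)
  refine hV.of_subset_convex
    ((convex_closedBall 0 C).inter (convex_halfSpace_ge (innerₗ E w).isLinear 1))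
    ((isCompact_closedBall 0 C).inter_right hclosed) (fun v hv => hloc v ?_) hJ
    (fun x hx => ⟨hC hx, hw x hx⟩) hi
  rintro rfl
  have h : (1 : ℝ) ≤ inner ℝ w 0 := hv.2
  norm_num [inner_zero_right] at h

variable {ι : Type*} {e : ι → E}

theorem GluesAtMidpoints.union_signedVectors [ProperSpace E] (hV : GluesAtMidpoints V)
    (hzero : ∀ i J, V i (insert 0 J) ↔ V i J) (hloc : ∀ v, v ≠ 0 → HoldsNear V m v)
    (he : Orthonormal ℝ e) {L : Finset ι} (hJ : J.Nonempty) (hJw : IsPointed J)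
    (hJL : ∀ l ∈ L, ∀ x ∈ J, inner ℝ (e l) x = 0) {i : ℤ} (hi : m + J.card + L.card ≤ i) :
    V i (J ∪ signedVectors e L) := by
  classical
  induction L using Finset.induction_on generalizing J i with
  | empty =>
    simpa [signedVectors] using hV.of_isPointed hloc hJ hJw (by simpa using hi)
  | insert l L hl ih =>
    rw [Finset.card_insert_of_notMem hl, Nat.cast_succ] at hi
    rw [Finset.forall_mem_insert] at hJL
    have hstep : ∀ x : E, ‖x‖ = 1 → (∀ y ∈ J, inner ℝ x y = 0) → (∀ k ∈ L, inner ℝ (e k) x = 0) →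
        V i (insert x (J ∪ signedVectors e L)) := fun x hx hxJ hxL => by
      have := Finset.card_insert_le x J
      rw [← Finset.insert_union]
      exact ih (Finset.insert_nonempty x J) (hJw.insert hx hxJ)
        (fun k hk => (Finset.forall_mem_insert _ _ _).2 ⟨hxL k hk, hJL.2 k hk⟩) (by omega)
    have horth : ∀ k ∈ L, inner ℝ (e k) (e l) = 0 := fun k hk =>
      he.2 (ne_of_mem_of_not_mem hk hl)
    rw [signedVectors_insert, Finset.union_insert, Finset.union_insert]
    refine hV.insert_neg hzero (hstep _ (he.1 l) hJL.1 horth) (hstep _ ?_ ?_ ?_)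
      (ih hJ hJw hJL.2 (by omega))
    · rw [norm_neg, he.1 l]
    · exact fun y hy => by rw [inner_neg_left, hJL.1 y hy, neg_zero]
    · exact fun k hk => by rw [inner_neg_right, horth k hk, neg_zero]

theorem DescendsToMidpoints.empty [ProperSpace E] [Fintype ι] (hV' : DescendsToMidpoints V)
    (hV : GluesAtMidpoints V) (hzero : ∀ i J, V i (insert 0 J) ↔ V i J)
    (hloc : ∀ v, v ≠ 0 → HoldsNear V m v) (he : Orthonormal ℝ e)
    (htop : ∀ i J, m + Fintype.card ι < i → V i J) {i : ℤ} (hi : m < i) : V i ∅ := by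
  classical
  have hcompl : ∀ (L : Finset ι) (i : ℤ), m + Lᶜ.card < i → V i (signedVectors e Lᶜ) := by
    intro L
    induction L using Finset.induction_on with
    | empty => exact fun i hi => htop i _ (by simpa using hi)
    | insert l L hl ih =>
      intro i hi
      have hlL : insert l (insert l L)ᶜ = Lᶜ := by
        rw [Finset.compl_insert, Finset.insert_erase (Finset.mem_compl.2 hl)]
      have hmem : l ∉ (insert l L)ᶜ := fun h => Finset.mem_compl.1 h (Finset.mem_insert_self l L)
      have horth : ∀ k ∈ (insert l L)ᶜ, inner ℝ (e k) (e l) = 0 := fun k hk =>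
        he.2 (ne_of_mem_of_not_mem hk hmem)
      have hstep : ∀ x : E, ‖x‖ = 1 → (∀ k ∈ (insert l L)ᶜ, inner ℝ (e k) x = 0) →
          V i (insert x (signedVectors e (insert l L)ᶜ)) := fun x hx hxL => by
        rw [Finset.insert_eq]
        refine hV.union_signedVectors hzero hloc he (Finset.singleton_nonempty x) ?_
          (fun k hk => by simpa using hxL k hk) (by rw [Finset.card_singleton]; omega)
        exact isPointed_empty.insert hx fun y hy => absurd hy (Finset.notMem_empty y)
      refine hV'.of_insert_neg hzero (hstep (e l) (he.1 l) horth) (hstep (-e l) ?_ ?_) ?_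
      · rw [norm_neg, he.1 l]
      · exact fun k hk => by rw [inner_neg_right, horth k hk, neg_zero]
      · rw [← signedVectors_insert, hlL]
        refine ih _ ?_
        rw [← hlL, Finset.card_insert_of_notMem hmem]
        omega
  simpa [signedVectors] using hcompl Finset.univ i (by simpa using hi)

end Subdivision

/-! ### Vanishing of the cohomology with coinduced coefficients -/

section LatticeCharacter

variable {G : Type v} [Group G] {r : ℕ} (θ : G →* Multiplicative (Fin r → ℤ))
variable {v : EuclideanSpace ℝ (Fin r)}

/-- The character `g ↦ ∑ v_l θ(g)_l` determined by a homomorphism `θ : G → ℤ^r` and a vector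
`v`. -/
def latticeCharacter (v : EuclideanSpace ℝ (Fin r)) : Character G where
  toFun g := Multiplicative.ofAdd (∑ l, v l * ((θ g).toAdd l : ℝ))
  map_one' := by simp
  map_mul' g h := by
    rw [← ofAdd_add, ← Finset.sum_add_distrib]
    simp [mul_add]

theorem toAdd_latticeCharacter (v : EuclideanSpace ℝ (Fin r)) (g : G) :
    (latticeCharacter θ v g).toAdd = ∑ l, v l * ((θ g).toAdd l : ℝ) := rfl

theorem latticeCharacter_zero : latticeCharacter θ 0 = 1 := by
  ext g
  simp [latticeCharacter]

theorem latticeCharacter_mul_latticeCharacter (a b : EuclideanSpace ℝ (Fin r)) :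
    latticeCharacter θ a * latticeCharacter θ b = latticeCharacter θ (midpoint ℝ a b) ^ 2 := by
  refine MonoidHom.ext fun g => Multiplicative.toAdd.injective ?_
  simp only [MonoidHom.mul_apply, MonoidHom.pow_apply, toAdd_mul, toAdd_pow, toAdd_latticeCharacter,
    midpoint_eq_smul_add, nsmul_eq_mul, ← Finset.sum_add_distrib, Finset.mul_sum]
  refine Finset.sum_congr rfl fun l _ => ?_
  simp only [PiLp.smul_apply, PiLp.add_apply, invOf_eq_inv, smul_eq_mul, Nat.cast_ofNat]
  ring

variable {θ}

theorem latticeCharacter_apply_eq_one (v : EuclideanSpace ℝ (Fin r)) {g : G} (hg : g ∈ θ.ker) :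
    latticeCharacter θ v g = 1 := by
  apply Multiplicative.toAdd.injective
  simp [toAdd_latticeCharacter, MonoidHom.mem_ker.1 hg]

theorem latticeCharacter_ne_one (hθ : Function.Surjective θ) (hv : v ≠ 0) :
    latticeCharacter θ v ≠ 1 := by
  refine fun h => hv (PiLp.ext fun l => ?_)
  obtain ⟨g, hg⟩ := hθ (Multiplicative.ofAdd (Pi.single l 1))
  have hgl := toAdd_latticeCharacter θ v g
  rw [h, hg, Finset.sum_eq_single_of_mem l (Finset.mem_univ l)] at hgl
  · simpa using hgl.symm
  · intro k _ hkl
    simp [hkl]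

theorem latticeCharacter_mem_charactersVanishingOn (hθ : Function.Surjective θ) (hv : v ≠ 0) :
    latticeCharacter θ v ∈ charactersVanishingOn θ.ker :=
  ⟨latticeCharacter_ne_one hθ hv, fun _ => latticeCharacter_apply_eq_one v⟩

theorem eventually_latticeCharacter_pos {T : Finset G}
    (hT : ∀ g ∈ T, 0 < (latticeCharacter θ v g).toAdd) :
    ∀ᶠ v' in nhds v, ∀ g ∈ T, 0 < (latticeCharacter θ v' g).toAdd := by
  refine (Filter.eventually_all_finset T).2 fun g hg => ?_
  have hc : Continuous fun v' : EuclideanSpace ℝ (Fin r) => (latticeCharacter θ v' g).toAdd := by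
    simp only [toAdd_latticeCharacter]
    fun_prop
  exact hc.continuousAt.eventually (lt_mem_nhds (hT g hg))

end LatticeCharacter

section ConeVanishing

variable {R : Type u} {G : Type v} [Ring R] [Group G] {r : ℕ}
variable {C : ChainComplex (ModuleCat.{max u v} (MonoidAlgebra R G)) ℤ}
variable {A : Type max u v} [AddCommGroup A] [Module R A]
variable {θ : G →* Multiplicative (Fin r → ℤ)} [DistribMulAction θ.ker A] [SMulCommClass R θ.ker A]
variable (C A θ) in
/-- The cohomology of `C` in degree `i` vanishes with coefficients in the functions coinduced from
`A` with support bounded below with respect to the characters corresponding to the vectors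
in `J`. -/
def ConeVanishing (i : ℤ) (J : Finset (EuclideanSpace ℝ (Fin r))) : Prop :=
  CohomologyVanishes C (coneModule R θ.ker A (latticeCharacter θ '' J)) i

theorem coneVanishing_insert [DecidableEq (EuclideanSpace ℝ (Fin r))] (i : ℤ)
    (v : EuclideanSpace ℝ (Fin r)) (J : Finset (EuclideanSpace ℝ (Fin r))) :
    ConeVanishing C A θ i (insert v J) ↔ CohomologyVanishes C
      (coneModule R θ.ker A (insert (latticeCharacter θ v) (latticeCharacter θ '' J))) i := by
  rw [ConeVanishing, Finset.coe_insert, Set.image_insert_eq]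

theorem coneVanishing_insert_zero [DecidableEq (EuclideanSpace ℝ (Fin r))] (i : ℤ)
    (J : Finset (EuclideanSpace ℝ (Fin r))) :
    ConeVanishing C A θ i (insert 0 J) ↔ ConeVanishing C A θ i J := by
  rw [coneVanishing_insert, latticeCharacter_zero, coneModule_insert_one, ConeVanishing]

variable [∀ i, Module.Projective (MonoidAlgebra R G) (C.X i)] {m n : ℤ}

theorem gluesAtMidpoints_coneVanishing [DecidableEq (EuclideanSpace ℝ (Fin r))] :
    GluesAtMidpoints (ConeVanishing C A θ) := by
  intro i a b J h₁ h₂ h₃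
  rw [coneVanishing_insert] at h₃
  rw [coneVanishing_insert, Finset.coe_insert, Set.image_insert_eq] at h₁ h₂ ⊢
  have hmid := latticeCharacter_mul_latticeCharacter θ a b
  rw [← coneModule_inf hmid]
  refine h₁.inf h₂ ?_
  rwa [coneModule_sup hmid (fun _ => latticeCharacter_apply_eq_one a)
    (fun _ => latticeCharacter_apply_eq_one b)]

theorem descendsToMidpoints_coneVanishing [DecidableEq (EuclideanSpace ℝ (Fin r))] :
    DescendsToMidpoints (ConeVanishing C A θ) := by
  intro i a b J h₁ h₂ h₃
  rw [coneVanishing_insert]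
  rw [coneVanishing_insert, Finset.coe_insert, Set.image_insert_eq] at h₁ h₂ h₃
  have hmid := latticeCharacter_mul_latticeCharacter θ a b
  rw [← coneModule_sup hmid (fun _ => latticeCharacter_apply_eq_one a)
    (fun _ => latticeCharacter_apply_eq_one b)]
  refine h₁.sup h₂ ?_
  rwa [coneModule_inf hmid]

theorem holdsNear_coneVanishing
    (hfin : ∀ i, m < i → Module.Finite (MonoidAlgebra R G) (C.X i))
    (hcd : complexCd C ≤ ((n : WithTop ℤ) : WithBot (WithTop ℤ)))
    {v : EuclideanSpace ℝ (Fin r)}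
    (hv : ∀ i, m < i → CohomologyVanishes C (novikov R (latticeCharacter θ v)) i) :
    HoldsNear (ConeVanishing C A θ) m v := by
  choose! T hT hTC using fun i => exists_hasApproxContraction hfin hcd
    (fun i hi => (hv i hi).of_linearEquiv (novikovEquiv R _)) (i := i)
  refine ⟨_, (Filter.eventually_all_finset (Finset.Ioc m n)).2 fun i hi =>
    eventually_latticeCharacter_pos (hT i (Finset.mem_Ioc.1 hi).1), fun J hJ hJU i hi => ?_⟩
  by_cases hin : n < i
  · exact complexCd_le_iff.1 hcd i hin (ModuleCat.of _ _)
  · refine (hTC i hi).cohomologyVanishes_coneModule (hJ.to_set.image _) ?_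
    rintro _ ⟨v', hv', rfl⟩
    exact hJU hv' i (Finset.mem_Ioc.2 ⟨hi, not_lt.1 hin⟩)

theorem cohomologyVanishes_coinduced (hθ : Function.Surjective θ)
    (hfin : ∀ i, m < i → Module.Finite (MonoidAlgebra R G) (C.X i))
    (hcd : complexCd C ≤ (((m + r : ℤ) : WithTop ℤ) : WithBot (WithTop ℤ)))
    (hv : ∀ φ ∈ charactersVanishingOn θ.ker, ∀ i, m < i → CohomologyVanishes C (novikov R φ) i)
    {i : ℤ} (hi : m < i) : CohomologyVanishes C (coinduced R θ.ker A) i := by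
  classical
  have h : ConeVanishing C A θ i ∅ := descendsToMidpoints_coneVanishing.empty
    gluesAtMidpoints_coneVanishing coneVanishing_insert_zero
    (fun v hv0 => holdsNear_coneVanishing hfin hcd
      (hv _ (latticeCharacter_mem_charactersVanishingOn hθ hv0)))
    (EuclideanSpace.basisFun (Fin r) ℝ).orthonormal
    (fun i J hi => complexCd_le_iff.1 hcd i (by simpa using hi) (ModuleCat.of _ _)) hi
  rwa [ConeVanishing, Finset.coe_empty, Set.image_empty, coneModule_empty] at h

end ConeVanishing

/-! ### Restriction to a subgroup and coinduction -/

section GroupRingModule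

variable {R : Type u} {G : Type v} {M : Type w} [Ring R] [Group G] [AddCommGroup M]

/-- The module structure over `R[G]` on `M` is the one determined by the actions of `R` and `G`. -/
class IsGroupRingModule (R : Type u) (G : Type v) (M : Type w) [Ring R] [Group G] [AddCommGroup M]
    [Module R M] [DistribMulAction G M] [Module (MonoidAlgebra R G) M] : Prop where
  single_smul (g : G) (r : R) (m : M) : MonoidAlgebra.single g r • m = r • g • m

/-- The underlying `R`-module of an `R[G]`-module. -/
abbrev scalarModule (R : Type u) (G : Type v) (M : Type w) [Ring R] [Group G] [AddCommGroup M]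
    [Module (MonoidAlgebra R G) M] : Module R M :=
  Module.compHom M (MonoidAlgebra.singleOneRingHom : R →+* MonoidAlgebra R G)

/-- The action of `G` on an `R[G]`-module. -/
abbrev groupAction (R : Type u) (G : Type v) (M : Type w) [Ring R] [Group G] [AddCommGroup M]
    [Module (MonoidAlgebra R G) M] : DistribMulAction G M :=
  DistribMulAction.compHom M (MonoidAlgebra.of R G)

theorem isGroupRingModule_scalarModule_groupAction [Module (MonoidAlgebra R G) M] :
    letI := scalarModule R G M
    letI := groupAction R G M
    IsGroupRingModule R G M :=
  letI := scalarModule R G M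
  letI := groupAction R G M
  ⟨fun g r m => by
    change _ = MonoidAlgebra.single (1 : G) r • MonoidAlgebra.single g (1 : R) • m
    rw [smul_smul, MonoidAlgebra.single_mul_single, one_mul, mul_one]⟩

variable [Module R M] [DistribMulAction G M] [Module (MonoidAlgebra R G) M]

theorem IsGroupRingModule.smulCommClass [IsGroupRingModule R G M] : SMulCommClass R G M where
  smul_comm r g m := by
    have hr : ∀ m : M, MonoidAlgebra.single (1 : G) r • m = r • m := fun m => by
      rw [single_smul, one_smul]
    have hg : ∀ m : M, MonoidAlgebra.single g (1 : R) • m = g • m := fun m => by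
      rw [single_smul, one_smul]
    rw [← hr, ← hg, ← hr, ← hg, smul_smul, smul_smul, MonoidAlgebra.single_mul_single,
      MonoidAlgebra.single_mul_single, one_mul, mul_one, one_mul, mul_one]

end GroupRingModule

section Coinduction

variable {R : Type u} {G : Type v} [Ring R] [Group G] {N : Subgroup G}

variable (R) in
/-- Restriction of `R[G]`-modules to a subgroup `N`. -/
abbrev restriction (N : Subgroup G) : ModuleCat.{max u v} (MonoidAlgebra R G) ⥤
    ModuleCat.{max u v} (MonoidAlgebra R N) :=
  ModuleCat.restrictScalars.{max u v} (MonoidAlgebra.mapDomainRingHom R N.subtype)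

variable {P Q : ModuleCat.{max u v} (MonoidAlgebra R G)}

variable (N P) in
/-- The elements of the restriction of `P` are those of `P`. -/
def restrictionEquiv : (restriction R N).obj P ≃+ P := AddEquiv.refl _

theorem restrictionEquiv_single_smul (x : N) (r : R) (p : (restriction R N).obj P) :
    restrictionEquiv N P (MonoidAlgebra.single x r • p) =
      MonoidAlgebra.single (x : G) r • restrictionEquiv N P p :=
  congrArg (fun c : MonoidAlgebra R G => c • restrictionEquiv N P p) MonoidAlgebra.mapDomain_single

theorem restrictionEquiv_symm_single_smul (x : N) (r : R) (p : P) :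
    (restrictionEquiv N P).symm (MonoidAlgebra.single (x : G) r • p) =
      MonoidAlgebra.single x r • (restrictionEquiv N P).symm p := by
  rw [AddEquiv.symm_apply_eq, restrictionEquiv_single_smul, AddEquiv.apply_symm_apply]

variable {M : Type w} [AddCommGroup M] [Module R M] [DistribMulAction N M]
variable [Module (MonoidAlgebra R N) M] [IsGroupRingModule R N M]

theorem map_restrictionEquiv_symm_single_smul
    (f : (restriction R N).obj P →ₗ[MonoidAlgebra R N] M) (x : N) (r : R) (p : P) :
    f ((restrictionEquiv N P).symm (MonoidAlgebra.single (x : G) r • p)) =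
      r • x • f ((restrictionEquiv N P).symm p) := by
  rw [restrictionEquiv_symm_single_smul, map_smul, IsGroupRingModule.single_smul]

variable [SMulCommClass R N M]

/-- Frobenius reciprocity: a map `f` from the restriction of `P` corresponds to the map that sends
`p` to the function `h ↦ f (h⁻¹ p)`. -/
def frobeniusEquiv : ((restriction R N).obj P →ₗ[MonoidAlgebra R N] M) ≃
    (P →ₗ[MonoidAlgebra R G] coinduced R N M) where
  toFun f := LinearMap.codRestrict (coinduced R N M)
    (linearMapOfSingle
      { toFun := fun p => ⟨fun h =>
          f ((restrictionEquiv N P).symm (MonoidAlgebra.single h⁻¹ (1 : R) • p))⟩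
        map_zero' := ext fun _ => by
          change f ((restrictionEquiv N P).symm (_ • 0)) = 0
          rw [smul_zero, map_zero, map_zero]
        map_add' := fun p q => ext fun _ => by
          change f ((restrictionEquiv N P).symm (_ • (p + q))) = _
          rw [smul_add, map_add, map_add]
          rfl }
      fun g r p => ext fun h => by
        have hf := map_restrictionEquiv_symm_single_smul f 1 r
          (MonoidAlgebra.single (g⁻¹ * h)⁻¹ (1 : R) • p)
        rw [one_smul, smul_smul, MonoidAlgebra.single_mul_single] at hf
        rw [single_smul_apply]
        refine Eq.trans ?_ hf
        change f ((restrictionEquiv N P).symm (_ • _ • p)) = _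
        rw [smul_smul, MonoidAlgebra.single_mul_single, Subgroup.coe_one, one_mul, one_mul,
          mul_one, mul_inv_rev, inv_inv])
    fun p x h => by
      have hf := map_restrictionEquiv_symm_single_smul f x⁻¹ 1
        (MonoidAlgebra.single h⁻¹ (1 : R) • p)
      rwa [smul_smul, MonoidAlgebra.single_mul_single, one_smul, one_mul, Subgroup.coe_inv,
        ← mul_inv_rev] at hf
  invFun F := linearMapOfSingle
    { toFun := fun p => (F (restrictionEquiv N P p)).1 1
      map_zero' := by rw [map_zero, map_zero]; rfl
      map_add' := fun p q => by rw [map_add, map_add]; rfl }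
    fun x r p => by
      have hF := (F (restrictionEquiv N P p)).2 x⁻¹ 1
      rw [one_mul, inv_inv, Subgroup.coe_inv] at hF
      change (F (restrictionEquiv N P (_ • p))).1 1 = _ • (F (restrictionEquiv N P p)).1 1
      rw [restrictionEquiv_single_smul, map_smul, Submodule.coe_smul, single_smul_apply, mul_one,
        hF, IsGroupRingModule.single_smul]
  left_inv f := LinearMap.ext fun p => by
    change f ((restrictionEquiv N P).symm (_ • _)) = f p
    rw [inv_one, ← MonoidAlgebra.one_def, one_smul, AddEquiv.symm_apply_apply]
  right_inv F := LinearMap.ext fun p => Subtype.ext <| ext fun h => by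
    change (F (MonoidAlgebra.single h⁻¹ (1 : R) • p)).1 1 = (F p).1 h
    rw [map_smul, Submodule.coe_smul, single_smul_apply, one_smul, inv_inv, mul_one]

theorem frobeniusEquiv_comp (f : (restriction R N).obj P →ₗ[MonoidAlgebra R N] M) (a : Q ⟶ P) :
    frobeniusEquiv (f ∘ₗ ((restriction R N).map a).hom) = frobeniusEquiv f ∘ₗ a.hom :=
  LinearMap.ext fun q => Subtype.ext <| ext fun _ => congrArg f (map_smul a.hom _ q)

theorem frobeniusEquiv_zero :
    frobeniusEquiv (0 : (restriction R N).obj P →ₗ[MonoidAlgebra R N] M) = 0 := rfl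

/-- Shapiro's lemma. -/
theorem cohomologyVanishes_resComplex_iff
    {C : ChainComplex (ModuleCat.{max u v} (MonoidAlgebra R G)) ℤ} {i : ℤ} :
    CohomologyVanishes (resComplex R N C) M i ↔ CohomologyVanishes C (coinduced R N M) i := by
  change (∀ f : (restriction R N).obj (C.X i) →ₗ[MonoidAlgebra R N] M,
    f ∘ₗ ((restriction R N).map (C.d (i + 1) i)).hom = 0 →
      ∃ h : (restriction R N).obj (C.X (i - 1)) →ₗ[MonoidAlgebra R N] M,
        h ∘ₗ ((restriction R N).map (C.d i (i - 1))).hom = f) ↔ _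
  refine frobeniusEquiv.forall_congr fun f => imp_congr ?_ (frobeniusEquiv.exists_congr fun h => ?_)
  · rw [← frobeniusEquiv.apply_eq_iff_eq, frobeniusEquiv_zero, frobeniusEquiv_comp]
  · rw [← frobeniusEquiv.apply_eq_iff_eq, frobeniusEquiv_comp]

end Coinduction

section CoinducedMap

variable {R : Type u} {G : Type v} [Ring R] [Group G] {N : Subgroup G}
variable {A : Type w} [AddCommGroup A] [Module R A] [DistribMulAction N A]
variable [Module (MonoidAlgebra R N) A] [IsGroupRingModule R N A]
variable {A' : Type w'} [AddCommGroup A'] [Module R A'] [DistribMulAction N A']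
variable [Module (MonoidAlgebra R N) A'] [IsGroupRingModule R N A']

theorem IsGroupRingModule.map_smul_smul (e : A →ₗ[MonoidAlgebra R N] A') (r : R) (x : N) (a : A) :
    e (r • x • a) = r • x • e a := by
  rw [← single_smul, map_smul, single_smul]

theorem IsGroupRingModule.map_smul_ring (e : A →ₗ[MonoidAlgebra R N] A') (r : R) (a : A) :
    e (r • a) = r • e a := by
  simpa only [one_smul] using map_smul_smul e r 1 a

theorem IsGroupRingModule.map_smul_group (e : A →ₗ[MonoidAlgebra R N] A') (x : N) (a : A) :
    e (x • a) = x • e a := by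
  simpa only [one_smul] using map_smul_smul e 1 x a

variable [SMulCommClass R N A] [SMulCommClass R N A']

variable (G) in
/-- Functoriality of coinduction. -/
def coinducedMap (e : A →ₗ[MonoidAlgebra R N] A') :
    coinduced R N A →ₗ[MonoidAlgebra R G] coinduced R N A' :=
  linearMapOfSingle
    { toFun := fun F => ⟨⟨fun h => e (F.1 h)⟩, fun x h => by
        change e (F.1 (h * x)) = x⁻¹ • e (F.1 h)
        rw [F.2, IsGroupRingModule.map_smul_group]⟩
      map_zero' := Subtype.ext <| ext fun _ => map_zero e
      map_add' := fun _ _ => Subtype.ext <| ext fun _ => map_add e _ _ }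
    fun g r F => Subtype.ext <| ext fun h => by
      change e ((MonoidAlgebra.single g r • F.1) h) =
        (MonoidAlgebra.single g r • (⟨fun h => e (F.1 h)⟩ : TranslationModule G A')) h
      rw [single_smul_apply, single_smul_apply, IsGroupRingModule.map_smul_ring]
      rfl

/-- A section of a surjection `e` extends from representatives of the cosets `G ⧸ N` to all of
`G` by equivariance. -/
theorem coinducedMap_surjective {e : A →ₗ[MonoidAlgebra R N] A'} (he : Function.Surjective e) :
    Function.Surjective (coinducedMap G e) := by
  intro F'
  choose s hs using he
  let rep : G → G := fun h => (QuotientGroup.mk (s := N) h).out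
  let n : G → N := fun h =>
    ⟨(rep h)⁻¹ * h, QuotientGroup.eq.1 (Quotient.out_eq' (QuotientGroup.mk (s := N) h))⟩
  have hrep : ∀ h (x : N), rep (h * x) = rep h := fun h x =>
    congrArg Quotient.out (QuotientGroup.mk_mul_of_mem h x.2)
  have hn : ∀ h (x : N), n (h * x) = n h * x := fun h x => Subtype.ext <| by
    change (rep (h * x))⁻¹ * (h * x) = (rep h)⁻¹ * h * x
    rw [hrep, mul_assoc]
  refine ⟨⟨⟨fun h => (n h)⁻¹ • s (F'.1 (rep h))⟩, fun x h => ?_⟩, Subtype.ext <| ext fun h => ?_⟩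
  · change (n (h * x))⁻¹ • s (F'.1 (rep (h * x))) = x⁻¹ • (n h)⁻¹ • s (F'.1 (rep h))
    rw [hn, hrep, mul_inv_rev, mul_smul]
  · change e ((n h)⁻¹ • s (F'.1 (rep h))) = F'.1 h
    rw [IsGroupRingModule.map_smul_group, hs, ← F'.2]
    exact congrArg F'.1 (mul_inv_cancel_left _ _)

instance : (restriction R N).PreservesProjectiveObjects where
  projective_obj {P} hP := by
    rw [← IsProjective.iff_projective] at hP
    refine ⟨fun {E Y} f e he => ?_⟩
    let := scalarModule R N E
    let := groupAction R N E
    let := scalarModule R N Y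
    let := groupAction R N Y
    have : IsGroupRingModule R N E := isGroupRingModule_scalarModule_groupAction
    have : IsGroupRingModule R N Y := isGroupRingModule_scalarModule_groupAction
    have : SMulCommClass R N E := IsGroupRingModule.smulCommClass
    have : SMulCommClass R N Y := IsGroupRingModule.smulCommClass
    obtain ⟨F, hF⟩ := Module.projective_lifting_property (coinducedMap G e.hom)
      (frobeniusEquiv (P := P) f.hom)
      (coinducedMap_surjective ((ModuleCat.epi_iff_surjective e).1 he))
    refine ⟨ModuleCat.ofHom (X := (restriction R N).obj P) (frobeniusEquiv.symm F),
      ModuleCat.hom_ext ?_⟩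
    exact (frobeniusEquiv.symm_apply_eq.2 hF :
      frobeniusEquiv.symm (coinducedMap G e.hom ∘ₗ F) = f.hom)

end CoinducedMap

section ComplexCd

variable {R : Type u} {G : Type v} [Ring R] [Group G] {r : ℕ}
variable {C : ChainComplex (ModuleCat.{max u v} (MonoidAlgebra R G)) ℤ}
variable [∀ i, Module.Projective (MonoidAlgebra R G) (C.X i)]
variable {θ : G →* Multiplicative (Fin r → ℤ)} {n : ℤ}

theorem complexCd_resComplex_le (hθ : Function.Surjective θ)
    (hfin : ∀ i, n - r < i → Module.Finite (MonoidAlgebra R G) (C.X i))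
    (hcd : complexCd C ≤ ((n : WithTop ℤ) : WithBot (WithTop ℤ)))
    (hv : ∀ φ ∈ charactersVanishingOn θ.ker, ∀ i : ℤ, n - r < i →
      Subsingleton (cohomology C (novikovModule R φ) i)) :
    complexCd (resComplex R θ.ker C) ≤ (((n - r : ℤ) : WithTop ℤ) : WithBot (WithTop ℤ)) := by
  refine complexCd_le_iff.2 fun i hi M => ?_
  let := scalarModule R θ.ker M
  let := groupAction R θ.ker M
  have : IsGroupRingModule R θ.ker M := isGroupRingModule_scalarModule_groupAction
  have : SMulCommClass R θ.ker M := IsGroupRingModule.smulCommClass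
  exact cohomologyVanishes_resComplex_iff.2 <| cohomologyVanishes_coinduced hθ hfin
    (by rwa [sub_add_cancel]) (fun φ hφ i hi => subsingleton_cohomology_iff.1 (hv φ hφ i hi)) hi

end ComplexCd

/-! ### Extensions by free abelian groups -/

section DifferenceOperator

variable {R : Type u} {G : Type v} [Ring R] [Group G]
variable {A : Type w} [AddCommGroup A]

theorem exists_add_one_sub_eq (u : ℤ → A) : ∃ W : ℤ → A, ∀ k, W (k + 1) - W k = u k := by
  let W : ℤ → A
    | .ofNat n => ∑ j ∈ Finset.range n, u j
    | .negSucc n => -∑ j ∈ Finset.range (n + 1), u (.negSucc j)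
  refine ⟨W, ?_⟩
  rintro (n | _ | n)
  · exact Finset.sum_range_succ_sub_sum fun j : ℕ => u j
  · change 0 - -∑ j ∈ Finset.range 1, u (.negSucc j) = u (.negSucc 0)
    rw [zero_sub, neg_neg, Finset.sum_range_one]
  · change -∑ j ∈ Finset.range (n + 1), u (.negSucc j) -
      -∑ j ∈ Finset.range (n + 1 + 1), u (.negSucc j) = u (.negSucc (n + 1))
    rw [neg_sub_neg, Finset.sum_range_succ_sub_sum]

variable {τ : G →* Multiplicative ℤ} {t : G} {H K : Subgroup G}

theorem exists_mul_right_sub_eq [K.Normal] (hτt : τ t = Multiplicative.ofAdd 1) (hKτ : K ≤ τ.ker)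
    {u : G → A} (hu : ∀ h, ∀ x ∈ K, u (h * x) = u h) :
    ∃ q : G → A, (∀ h, q (h * t) - q h = u h) ∧ ∀ h, ∀ x ∈ K, q (h * x) = q h := by
  choose W hW using exists_add_one_sub_eq (A := A)
  let c : G → ℤ := fun h => (τ h).toAdd
  have hct : ∀ h, c (h * t) = c h + 1 := fun h => by
    simp only [c, map_mul, hτt, toAdd_mul, toAdd_ofAdd]
  have hcx : ∀ h, ∀ x ∈ K, c (h * x) = c h := fun h x hx => by
    simp only [c, map_mul, MonoidHom.mem_ker.1 (hKτ hx), mul_one]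
  let w : G → ℤ → A := fun h k => u (h * t ^ (k - c h))
  have hwt : ∀ h, w (h * t) = w h := fun h => funext fun k => congrArg u <| by
    rw [hct, mul_assoc, ← zpow_one_add, add_sub, add_comm 1 k, add_sub_add_right_eq_sub]
  have hwx : ∀ h, ∀ x ∈ K, w (h * x) = w h := fun h x hx => funext fun k => by
    change u (h * x * t ^ (k - c (h * x))) = u (h * t ^ (k - c h))
    rw [← hu (h * t ^ (k - c h)) _ (Subgroup.Normal.conj_mem' ‹_› x hx (t ^ (k - c h))), hcx h x hx]
    group
  refine ⟨fun h => W (w h) (c h), fun h => ?_, fun h x hx => ?_⟩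
  · simp only [hwt, hct, hW]
    simp only [w, sub_self, zpow_zero, mul_one]
  · simp only [hwx h x hx, hcx h x hx]

variable [Module R A] [DistribMulAction G A] [SMulCommClass R G A]

variable (R A) in
/-- The difference operator on the module coinduced from a normal subgroup `K`; when `t` and `K`
generate a larger subgroup `H`, its kernel is the module coinduced from `H`. -/
def differenceOperator (K : Subgroup G) [K.Normal] (t : G) :
    coinduced R K A →ₗ[MonoidAlgebra R G] coinduced R K A :=
  linearMapOfSingle
    { toFun := fun F => ⟨⟨fun h => t • F.1 (h * t) - F.1 h⟩, fun x h => by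
        have hconj : F.1 (h * t * (t⁻¹ * x * t)) = (t⁻¹ * x * t)⁻¹ • F.1 (h * t) :=
          F.2 ⟨_, Subgroup.Normal.conj_mem' ‹_› (x : G) x.2 t⟩ (h * t)
        have hx : F.1 (h * x) = (x : G)⁻¹ • F.1 h := F.2 x h
        change t • F.1 (h * x * t) - F.1 (h * x) = (x : G)⁻¹ • (t • F.1 (h * t) - F.1 h)
        rw [show h * x * t = h * t * (t⁻¹ * x * t) by group, hconj, hx, smul_sub, smul_smul,
          smul_smul]
        group⟩
      map_zero' := Subtype.ext <| ext fun _ => by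
        change t • (0 : A) - 0 = 0
        rw [smul_zero, sub_zero]
      map_add' := fun F F' => Subtype.ext <| ext fun h => by
        change t • (F.1 (h * t) + F'.1 (h * t)) - (F.1 h + F'.1 h) =
          t • F.1 (h * t) - F.1 h + (t • F'.1 (h * t) - F'.1 h)
        rw [smul_add, add_sub_add_comm] }
    fun g r F => Subtype.ext <| ext fun h => by
      rw [Submodule.coe_smul, single_smul_apply]
      change t • (MonoidAlgebra.single g r • F.1) (h * t) - (MonoidAlgebra.single g r • F.1) h =
        r • (t • F.1 (g⁻¹ * h * t) - F.1 (g⁻¹ * h))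
      rw [single_smul_apply, single_smul_apply, ← smul_comm r t, smul_sub, mul_assoc]

theorem differenceOperator_surjective [K.Normal] (hτt : τ t = Multiplicative.ofAdd 1)
    (hKτ : K ≤ τ.ker) : Function.Surjective (differenceOperator R A K t) := by
  intro U
  obtain ⟨q, hqt, hqx⟩ := exists_mul_right_sub_eq hτt hKτ (u := fun h => h • U.1 h)
    fun h x hx => by
      rw [U.2 ⟨x, hx⟩ h, mul_smul]
      exact congrArg (h • ·) (smul_inv_smul x _)
  refine ⟨⟨⟨fun h => h⁻¹ • q h⟩, fun x h => ?_⟩, Subtype.ext <| ext fun h => ?_⟩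
  · change (h * x)⁻¹ • q (h * x) = (x : G)⁻¹ • h⁻¹ • q h
    rw [hqx h x x.2, mul_inv_rev, mul_smul]
  · change t • (h * t)⁻¹ • q (h * t) - h⁻¹ • q h = U.1 h
    rw [mul_inv_rev, mul_smul, smul_inv_smul, ← smul_sub, hqt, inv_smul_smul]

theorem coinduced_anti (hKH : K ≤ H) : coinduced R H A ≤ coinduced R K A :=
  fun _ hF x h => hF ⟨x, hKH x.2⟩ h

theorem apply_mul_zpow {F : TranslationModule G A} (hF : ∀ h, t • F (h * t) = F h) (k : ℤ) (h : G) :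
    t ^ k • F (h * t ^ k) = F h := by
  induction k with
  | zero => rw [zpow_zero, one_smul, mul_one]
  | succ k ih => rw [zpow_add_one, mul_smul, ← mul_assoc, hF, ih]
  | pred k ih => rw [← hF (h * t ^ (-(k : ℤ) - 1)), smul_smul, mul_assoc, ← zpow_add_one,
      sub_add_cancel, ih]

theorem exact_inclusion_differenceOperator [K.Normal] (hKH : K ≤ H) (ht : t ∈ H)
    (hgen : ∀ x ∈ H, ∃ k : ℤ, t ^ k * x ∈ K) :
    Function.Exact (Submodule.inclusion (coinduced_anti (R := R) (A := A) hKH))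
      (differenceOperator R A K t) := by
  intro F
  constructor
  · intro hF
    have hFt : ∀ h, t • F.1 (h * t) = F.1 h := fun h =>
      sub_eq_zero.1 (congrArg (fun F : coinduced R K A => F.1 h) hF)
    refine ⟨⟨F.1, fun x h => ?_⟩, rfl⟩
    obtain ⟨k, hk⟩ := hgen x x.2
    have hFx : F.1 (h * t ^ (-k) * (t ^ k * x)) = (t ^ k * x)⁻¹ • F.1 (h * t ^ (-k)) :=
      F.2 ⟨_, hk⟩ (h * t ^ (-k))
    rw [mul_inv_rev, mul_smul, ← zpow_neg, apply_mul_zpow hFt] at hFx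
    rwa [show h * t ^ (-k) * (t ^ k * x) = h * x by group] at hFx
  · rintro ⟨F, rfl⟩
    refine Subtype.ext <| ext fun h => ?_
    exact sub_eq_zero.2 ((congrArg (t • ·) (F.2 ⟨t, ht⟩ h)).trans (smul_inv_smul t (F.1 h)))

end DifferenceOperator

section Wang

variable {R : Type u} {G : Type v} [Ring R] [Group G]
variable {C : ChainComplex (ModuleCat.{w'} (MonoidAlgebra R G)) ℤ}
variable [∀ i, Module.Projective (MonoidAlgebra R G) (C.X i)]
variable {A : Type w} [AddCommGroup A] [Module R A] [DistribMulAction G A] [SMulCommClass R G A]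

theorem CohomologyVanishes.coinduced_of_inf_ker {H : Subgroup G} [H.Normal] {t : G}
    {τ : G →* Multiplicative ℤ} {i : ℤ} (ht : t ∈ H) (hτt : τ t = Multiplicative.ofAdd 1)
    (h : CohomologyVanishes C (coinduced R (H ⊓ τ.ker) A) i)
    (h' : CohomologyVanishes C (coinduced R (H ⊓ τ.ker) A) (i - 1)) :
    CohomologyVanishes C (coinduced R H A) i := by
  refine of_exact_left (Submodule.inclusion_injective _)
    (exact_inclusion_differenceOperator inf_le_left ht fun x hx => ?_)
    (differenceOperator_surjective hτt inf_le_right) h h'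
  refine ⟨-(τ x).toAdd, mul_mem (zpow_mem ht _) hx, MonoidHom.mem_ker.2 ?_⟩
  rw [map_mul, map_zpow, hτt, ← ofAdd_zsmul, smul_eq_mul, mul_one, ofAdd_neg, ofAdd_toAdd,
    inv_mul_cancel]

theorem CohomologyVanishes.coinduced_top {ι : Type*} {τ : ι → G →* Multiplicative ℤ} {t : ι → G}
    (hτt : ∀ k, τ k (t k) = Multiplicative.ofAdd 1) (hτt' : ∀ k l, k ≠ l → τ k (t l) = 1)
    (S : Finset ι) {m : ℤ}
    (h : ∀ i, m < i → CohomologyVanishes C (coinduced R (⨅ k ∈ S, (τ k).ker) A) i) :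
    ∀ i, m + S.card < i → CohomologyVanishes C (coinduced R (⊤ : Subgroup G) A) i := by
  classical
  induction S using Finset.induction_on generalizing m with
  | empty =>
    rw [show ⨅ k ∈ (∅ : Finset ι), (τ k).ker = ⊤ by simp] at h
    simpa only [Finset.card_empty, Nat.cast_zero, add_zero] using h
  | insert l S hl ih =>
    intro i hi
    rw [Finset.card_insert_of_notMem hl] at hi
    rw [Finset.iInf_insert, inf_comm] at h
    have hnormal : (⨅ k ∈ S, (τ k).ker).Normal :=
      Subgroup.normal_iInf_normal fun _ => Subgroup.normal_iInf_normal fun _ => inferInstance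
    have ht : t l ∈ ⨅ k ∈ S, (τ k).ker := by
      simp only [Subgroup.mem_iInf, MonoidHom.mem_ker]
      exact fun k hk => hτt' k l (ne_of_mem_of_not_mem hk hl)
    refine ih (m := m + 1) (fun i hi => ?_) i (by push_cast at hi; omega)
    exact coinduced_of_inf_ker ht (hτt l) (h i (by omega)) (h (i - 1) (by omega))

theorem coinduced_top_apply (F : coinduced R (⊤ : Subgroup G) A) (h : G) :
    F.1 h = h⁻¹ • F.1 1 :=
  (congrArg F.1 (one_mul h).symm).trans (F.2 ⟨h, Subgroup.mem_top h⟩ 1)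

/-- Evaluation at `1` identifies the module coinduced from `G` itself with the original one. -/
def coinducedTopEquiv [Module (MonoidAlgebra R G) A] [IsGroupRingModule R G A] :
    coinduced R (⊤ : Subgroup G) A ≃ₗ[MonoidAlgebra R G] A where
  __ := linearMapOfSingle
    { toFun := fun F : coinduced R (⊤ : Subgroup G) A => F.1 1
      map_zero' := rfl
      map_add' := fun _ _ => rfl } fun g r F => by
        change (MonoidAlgebra.single g r • F.1) 1 = MonoidAlgebra.single g r • F.1 1
        rw [single_smul_apply, mul_one, IsGroupRingModule.single_smul, coinduced_top_apply, inv_inv]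
  invFun a := ⟨⟨fun h => h⁻¹ • a⟩, fun x h => by
    change (h * x)⁻¹ • a = (x : G)⁻¹ • h⁻¹ • a
    rw [mul_inv_rev, mul_smul]⟩
  left_inv F := Subtype.ext <| ext fun h => (coinduced_top_apply F h).symm
  right_inv a := by
    change (1 : G)⁻¹ • a = a
    rw [inv_one, one_smul]

variable {r : ℕ} {θ : G →* Multiplicative (Fin r → ℤ)} {m : ℤ}

variable (θ) in
/-- The `k`th coordinate of `θ`. -/
def coordinate (k : Fin r) : G →* Multiplicative ℤ :=
  (AddMonoidHom.toMultiplicative (Pi.evalAddMonoidHom (fun _ => ℤ) k)).comp θ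

theorem iInf_ker_coordinate : ⨅ k ∈ Finset.univ, (coordinate θ k).ker = θ.ker := by
  ext g
  simp only [Finset.mem_univ, iInf_true, Subgroup.mem_iInf, MonoidHom.mem_ker]
  exact funext_iff.symm

theorem CohomologyVanishes.of_coinduced_ker [Module (MonoidAlgebra R G) A] [IsGroupRingModule R G A]
    (hθ : Function.Surjective θ)
    (h : ∀ i, m < i → CohomologyVanishes C (coinduced R θ.ker A) i) {i : ℤ} (hi : m + r < i) :
    CohomologyVanishes C A i := by
  choose t ht using fun k : Fin r => hθ (Multiplicative.ofAdd (Pi.single k 1))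
  have htk : ∀ k l, coordinate θ k (t l) = Multiplicative.ofAdd ((Pi.single l 1 : Fin r → ℤ) k) :=
    fun k l => congrArg (fun z => Multiplicative.ofAdd (z.toAdd k)) (ht l)
  rw [← iInf_ker_coordinate] at h
  refine (coinduced_top (t := t) (fun k => ?_) (fun k l hkl => ?_) Finset.univ h i
    (by rwa [Finset.card_fin])).of_linearEquiv coinducedTopEquiv
  · rw [htk, Pi.single_eq_same]
  · rw [htk, Pi.single_eq_of_ne hkl, ofAdd_zero]

end Wang

section ComplexCd

variable {R : Type u} {G : Type v} [Ring R] [Group G] {r : ℕ}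
variable {C : ChainComplex (ModuleCat.{max u v} (MonoidAlgebra R G)) ℤ}
variable [∀ i, Module.Projective (MonoidAlgebra R G) (C.X i)]
variable {θ : G →* Multiplicative (Fin r → ℤ)} {m : ℤ}

theorem complexCd_le_add (hθ : Function.Surjective θ)
    (h : complexCd (resComplex R θ.ker C) ≤ ((m : WithTop ℤ) : WithBot (WithTop ℤ))) :
    complexCd C ≤ (((m + r : ℤ) : WithTop ℤ) : WithBot (WithTop ℤ)) := by
  refine complexCd_le_iff.2 fun i hi M => ?_
  let := scalarModule R G M
  let := groupAction R G M
  have : IsGroupRingModule R G M := isGroupRingModule_scalarModule_groupAction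
  have : SMulCommClass R G M := IsGroupRingModule.smulCommClass
  let : Module (MonoidAlgebra R θ.ker) M := Module.compHom M
    (MonoidAlgebra.mapDomainRingHom R θ.ker.subtype)
  have : IsGroupRingModule R θ.ker M := ⟨fun x s a =>
    (congrArg (· • a) MonoidAlgebra.mapDomain_single).trans (IsGroupRingModule.single_smul _ _ _)⟩
  exact CohomologyVanishes.of_coinduced_ker hθ (fun i hi => cohomologyVanishes_resComplex_iff.1
    (complexCd_le_iff.1 h i hi (ModuleCat.of (MonoidAlgebra R θ.ker) M))) hi

end ComplexCd

/-! ### Projective resolutions as complexes in integer degrees -/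

section Extension

variable {B : Type u} [Ring B] {C : ChainComplex (ModuleCat.{w} B) ℤ}

/-- The inclusion of the degrees `ℕ` into `ℤ`, for homologically indexed complexes. -/
def embeddingNat : (ComplexShape.down ℕ).Embedding (ComplexShape.down ℤ) :=
  ComplexShape.Embedding.mk' _ _ (fun a => (a : ℤ)) Nat.cast_injective fun a b => by
    simp only [ComplexShape.down_Rel]
    omega

/-- A chain complex in degrees `ℕ`, extended by zero to negative degrees. -/
abbrev extendByZero (K : ChainComplex (ModuleCat.{w} B) ℕ) : ChainComplex (ModuleCat.{w} B) ℤ :=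
  K.extend embeddingNat

variable {K : ChainComplex (ModuleCat.{w} B) ℕ}

variable (K) in
/-- The term of `extendByZero K` in degree `a ≥ 0` is that of `K`. -/
def extendByZeroXIso (a : ℕ) : (extendByZero K).X a ≅ K.X a :=
  K.extendXIso embeddingNat rfl

theorem extendByZero_d_comp_hom (a b : ℕ) :
    (extendByZero K).d a b ≫ (extendByZeroXIso K b).hom =
      (extendByZeroXIso K a).hom ≫ K.d a b := by
  rw [K.extend_d_eq embeddingNat (i' := a) (j' := b) rfl rfl]
  simp only [extendByZeroXIso, Category.assoc, Iso.inv_hom_id, Category.comp_id]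

theorem subsingleton_extendByZero_X {i : ℤ} (hi : i < 0) : Subsingleton ((extendByZero K).X i) :=
  ModuleCat.subsingleton_of_isZero <| K.isZero_extend_X embeddingNat i fun a ha =>
    (Int.natCast_nonneg a).not_gt (ha.trans_lt hi)

theorem projective_extendByZero_X [Small.{w} B] (hK : ∀ a, Projective (K.X a)) (i : ℤ) :
    Module.Projective B ((extendByZero K).X i) := by
  rcases lt_or_ge i 0 with hi | hi
  · have := subsingleton_extendByZero_X (K := K) hi
    infer_instance
  · lift i to ℕ using hi
    exact (IsProjective.iff_projective _).2 (Projective.of_iso (extendByZeroXIso K i).symm (hK i))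

theorem finite_extendByZero_X {m : ℤ} (hK : ∀ a : ℕ, m < a → Module.Finite B (K.X a)) {i : ℤ}
    (hi : m < i) : Module.Finite B ((extendByZero K).X i) := by
  rcases lt_or_ge i 0 with hi' | hi'
  · have := subsingleton_extendByZero_X (K := K) hi'
    infer_instance
  · lift i to ℕ using hi'
    have := hK i hi
    exact Module.Finite.equiv (extendByZeroXIso K i).symm.toLinearEquiv

theorem CohomologyVanishes.of_subsingleton {M : Type w'} [AddCommGroup M] [Module B M] {i : ℤ}
    [Subsingleton (C.X i)] : CohomologyVanishes C M i :=
  fun _ _ => ⟨0, Subsingleton.elim _ _⟩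

end Extension

section Ext

theorem subsingleton_ext_zero_iff {𝒜 : Type w} [Category.{w'} 𝒜] [Abelian 𝒜] [HasExt.{u} 𝒜]
    {Z M : 𝒜} (Q : ProjectiveResolution Z) : Subsingleton (Abelian.Ext Z M 0) ↔
      ∀ f : Q.complex.X 0 ⟶ M, Q.complex.d 1 0 ≫ f = 0 → f = 0 := by
  refine ⟨fun hs f hf => ?_, fun h => subsingleton_of_forall_eq 0 fun α => ?_⟩
  · obtain ⟨g, rfl⟩ := Limits.CokernelCofork.IsColimit.desc' Q.isColimitCokernelCofork f hf
    have hg : (show Z ⟶ M from g) = 0 :=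
      (Abelian.Ext.mk₀_eq_zero_iff _).1 (Subsingleton.elim _ _)
    exact (congrArg (Q.cokernelCofork.π ≫ ·) hg).trans Limits.comp_zero
  · obtain ⟨f, hf, rfl⟩ := Q.extMk_surjective α _ rfl
    obtain rfl := h f hf
    exact Q.extMk_zero _ _

theorem subsingleton_ext_succ_iff {𝒜 : Type w} [Category.{w'} 𝒜] [Abelian 𝒜] [HasExt.{u} 𝒜]
    {Z M : 𝒜} (Q : ProjectiveResolution Z) {a : ℕ} : Subsingleton (Abelian.Ext Z M (a + 1)) ↔
      ∀ f : Q.complex.X (a + 1) ⟶ M, Q.complex.d (a + 2) (a + 1) ≫ f = 0 →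
        ∃ h : Q.complex.X a ⟶ M, Q.complex.d (a + 1) a ≫ h = f := by
  refine ⟨fun hs f hf => ?_, fun h => subsingleton_of_forall_eq 0 fun α => ?_⟩
  · exact (Q.extMk_eq_zero_iff f _ rfl hf a rfl).1 (Subsingleton.elim _ _)
  · obtain ⟨f, hf, rfl⟩ := Q.extMk_surjective α _ rfl
    exact (Q.extMk_eq_zero_iff f _ rfl hf a rfl).2 (h f hf)

variable {B : Type u} [Ring B] {C : ChainComplex (ModuleCat.{w} B) ℤ} {Z M : ModuleCat.{w} B}

theorem cohomologyVanishes_zero_iff [Subsingleton (C.X (-1))] : CohomologyVanishes C M 0 ↔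
    ∀ f : C.X 0 ⟶ M, C.d 1 0 ≫ f = 0 → f = 0 := by
  refine ⟨fun h f hf => ?_, fun h f hf => ⟨0, ?_⟩⟩
  · obtain ⟨g, hg⟩ := h f.hom (congrArg ModuleCat.Hom.hom hf)
    have hg0 : g = 0 := LinearMap.ext fun x => by
      rw [Subsingleton.elim (α := C.X (-1)) (show C.X (-1) from x) 0, map_zero, map_zero]
    rw [hg0, LinearMap.zero_comp] at hg
    exact ModuleCat.hom_ext hg.symm
  · rw [LinearMap.zero_comp]
    exact (congrArg ModuleCat.Hom.hom (h (ModuleCat.ofHom f) (ModuleCat.hom_ext hf))).symm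

theorem cohomologyVanishes_add_one_iff {i : ℤ} : CohomologyVanishes C M (i + 1) ↔
    ∀ f : C.X (i + 1) ⟶ M, C.d (i + 2) (i + 1) ≫ f = 0 →
      ∃ h : C.X i ⟶ M, C.d (i + 1) i ≫ h = f := by
  rw [CohomologyVanishes, add_sub_cancel_right, add_assoc, one_add_one_eq_two]
  refine ⟨fun h f hf => ?_, fun h f hf => ?_⟩
  · obtain ⟨g, hg⟩ := h f.hom (congrArg ModuleCat.Hom.hom hf)
    exact ⟨ModuleCat.ofHom g, ModuleCat.hom_ext hg⟩
  · obtain ⟨g, hg⟩ := h (ModuleCat.ofHom f) (ModuleCat.hom_ext hf)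
    exact ⟨g.hom, congrArg ModuleCat.Hom.hom hg⟩

variable {Q : ProjectiveResolution Z} {φ : ∀ a : ℕ, C.X a ≅ Q.complex.X a}

theorem cohomologyVanishes_natCast_iff [HasExt.{w'} (ModuleCat.{w} B)]
    (hφ : ∀ a b : ℕ, C.d a b ≫ (φ b).hom = (φ a).hom ≫ Q.complex.d a b)
    [Subsingleton (C.X (-1))] (a : ℕ) :
    CohomologyVanishes C M a ↔ Subsingleton (Abelian.Ext Z M a) := by
  have hcocycle : ∀ {a b : ℕ} (f : Q.complex.X b ⟶ M),
      Q.complex.d a b ≫ f = 0 ↔ C.d a b ≫ (φ b).hom ≫ f = 0 := fun {a b} f => by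
    rw [← Category.assoc, hφ, Category.assoc, ← cancel_epi (φ a).hom, Limits.comp_zero]
  cases a with
  | zero =>
    refine cohomologyVanishes_zero_iff.trans (Iff.trans ?_ (subsingleton_ext_zero_iff Q).symm)
    exact ((φ 0).symm.homFromEquiv.forall_congr fun f =>
      imp_congr (hcocycle f) (Preadditive.IsIso.comp_left_eq_zero _ _).symm).symm
  | succ a =>
    refine (cohomologyVanishes_add_one_iff (i := a)).trans
      (Iff.trans ?_ (subsingleton_ext_succ_iff Q).symm)
    refine ((φ (a + 1)).symm.homFromEquiv.forall_congr fun f => imp_congr (hcocycle f)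
      ((φ a).symm.homFromEquiv.exists_congr fun g => ?_)).symm
    change _ ↔ C.d (a + 1 : ℕ) a ≫ (φ a).hom ≫ g = (φ (a + 1)).hom ≫ f
    rw [← Category.assoc, hφ, Category.assoc, cancel_epi]

theorem projectiveDimension_lt_iff_complexCd_le [Small.{w} B]
    (hφ : ∀ a b : ℕ, C.d a b ≫ (φ b).hom = (φ a).hom ≫ Q.complex.d a b)
    (hC : ∀ i < 0, Subsingleton (C.X i)) {k : ℕ} :
    projectiveDimension Z < k ↔
      complexCd C ≤ (((k - 1 : ℤ) : WithTop ℤ) : WithBot (WithTop ℤ)) := by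
  have := hC (-1) neg_one_lt_zero
  rw [projectiveDimension_lt_iff, complexCd_le_iff]
  refine ⟨fun h i hi M => ?_, fun h => HasProjectiveDimensionLT.mk.{w} fun a ha M α => ?_⟩
  · rcases lt_or_ge i 0 with hi' | hi'
    · have := hC i hi'
      exact .of_subsingleton
    · lift i to ℕ using hi'
      exact (cohomologyVanishes_natCast_iff hφ i).2
        (HasProjectiveDimensionLT.subsingleton.{w} Z k i (by omega) M)
  · have := (cohomologyVanishes_natCast_iff hφ a).1 (h a (by omega) M)
    exact Subsingleton.elim _ _

end Ext

section Restriction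

variable {R : Type u} {G : Type v} [Ring R] [Group G] {N : Subgroup G}
variable {Z : ModuleCat.{max u v} (MonoidAlgebra R G)} {Q : ProjectiveResolution Z}

instance : (restriction R N).PreservesHomology :=
  ((CategoryTheory.Functor.exact_tfae (restriction R N)).out 1 2).1 fun S hS => by
    rw [ShortComplex.ShortExact.moduleCat_exact_iff_function_exact] at hS ⊢
    exact hS

theorem subsingleton_ext_iff_cohomologyVanishes
    {M : ModuleCat.{max u v} (MonoidAlgebra R G)} (a : ℕ) :
    Subsingleton (Abelian.Ext.{max u v} Z M a) ↔
      CohomologyVanishes (extendByZero Q.complex) M a :=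
  have := subsingleton_extendByZero_X (K := Q.complex) neg_one_lt_zero
  (cohomologyVanishes_natCast_iff extendByZero_d_comp_hom a).symm

variable (Q) in
theorem projectiveDimension_lt_iff_complexCd_extendByZero_le {k : ℕ} :
    projectiveDimension Z < k ↔ complexCd (extendByZero Q.complex) ≤
      (((k - 1 : ℤ) : WithTop ℤ) : WithBot (WithTop ℤ)) :=
  projectiveDimension_lt_iff_complexCd_le extendByZero_d_comp_hom
    fun _ => subsingleton_extendByZero_X

variable (Q N) in
theorem projectiveDimension_restriction_lt_iff {k : ℕ} :
    projectiveDimension ((restriction R N).obj Z) < k ↔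
      complexCd (resComplex R N (extendByZero Q.complex)) ≤
        (((k - 1 : ℤ) : WithTop ℤ) : WithBot (WithTop ℤ)) := by
  refine projectiveDimension_lt_iff_complexCd_le
    (Q := (restriction R N).mapProjectiveResolution Q)
    (φ := fun a => (restriction R N).mapIso (extendByZeroXIso Q.complex a)) (fun a b => ?_)
    fun i hi => subsingleton_extendByZero_X (K := Q.complex) hi
  exact ((restriction R N).map_comp _ _).symm.trans
    ((congrArg (restriction R N).map (extendByZero_d_comp_hom a b)).trans
      ((restriction R N).map_comp _ _))

variable (R N) in
/-- The restriction of the trivial module is the trivial module. -/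
def restrictionTrivialIso : (restriction R N).obj (trivialModule R G) ≅ trivialModule R N :=
  have h : (augmentation R G).comp (MonoidAlgebra.mapDomainRingHom R N.subtype) =
      augmentation R N := by
    ext <;> simp [augmentation]
  let e : (restriction R N).obj (trivialModule R G) ≃ₗ[MonoidAlgebra R N] trivialModule R N :=
    { restrictionEquiv N (trivialModule R G) with
      map_smul' := fun c a => congrArg (fun ε : MonoidAlgebra R N →+* R =>
        ε c • (show TrivialCarrier R G from a)) h }
  e.toModuleIso

end Restriction

section Group

variable {R : Type u} {G : Type v} [Ring R] [Group G] {r : ℕ}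

theorem cd_subgroup_lt_iff (P : ProjectiveResolution (trivialModule R G)) (N : Subgroup G)
    {k : ℕ} : cd R N < k ↔ complexCd (resComplex R N (extendByZero P.complex)) ≤
      (((k - 1 : ℤ) : WithTop ℤ) : WithBot (WithTop ℤ)) := by
  rw [cd, ← projectiveDimension_eq_of_iso (restrictionTrivialIso R N),
    projectiveDimension_restriction_lt_iff N P]

variable (R G) in
theorem cd_eq_bot_iff : cd R G = ⊥ ↔ Subsingleton R := by
  rw [cd, projectiveDimension_eq_bot_iff, ModuleCat.isZero_iff_subsingleton]
  exact Equiv.ulift.subsingleton_congr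

variable {θ : G →* Multiplicative (Fin r → ℤ)}

theorem cd_ker_lt (hθ : Function.Surjective θ) {n : ℕ} (hcd : cd R G ≤ n)
    {P : ProjectiveResolution (trivialModule R G)}
    (hfin : ∀ i : ℕ, (n : ℤ) - r < i → Module.Finite (MonoidAlgebra R G) (P.complex.X i))
    (hv : ∀ φ ∈ charactersVanishingOn θ.ker, ∀ i : ℕ, n < i + r →
      Subsingleton (groupCohom R G (novikovModule R φ) i)) {k : ℕ} (hk : n < k + r) :
    cd R θ.ker < k := by
  have := projective_extendByZero_X P.projective
  refine (cd_subgroup_lt_iff P θ.ker).2 <| (complexCd_resComplex_le hθ (n := n)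
    (fun i hi => finite_extendByZero_X hfin hi) ?_ fun φ hφ i hi => ?_).trans ?_
  · rw [← add_sub_cancel_right (n : ℤ) 1, ← Nat.cast_add_one]
    exact (projectiveDimension_lt_iff_complexCd_extendByZero_le P).1
      (projectiveDimension_lt_iff.2 ((projectiveDimension_le_iff _ _).1 hcd))
  · rw [subsingleton_cohomology_iff]
    rcases lt_or_ge i 0 with hi' | hi'
    · have := subsingleton_extendByZero_X (K := P.complex) hi'
      exact .of_subsingleton
    · lift i to ℕ using hi'
      exact (subsingleton_ext_iff_cohomologyVanishes i).1 (hv φ hφ i (by omega))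
  · exact WithBot.coe_le_coe.2 (WithTop.coe_le_coe.2 (by omega))

theorem cd_lt_add (hθ : Function.Surjective θ) {k : ℕ} (h : cd R θ.ker < k) :
    cd R G < (k + r : ℕ) := by
  let P := ProjectiveResolution.of (trivialModule R G)
  have := projective_extendByZero_X P.projective
  rw [cd_subgroup_lt_iff P] at h
  rw [cd, projectiveDimension_lt_iff_complexCd_extendByZero_le P, Nat.cast_add, add_sub_right_comm]
  exact complexCd_le_add hθ h

theorem cd_ker_eq (hθ : Function.Surjective θ) {n : ℕ} (hG : IsFPStar R G r) (hn : cd R G = n)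
    (hS : charactersVanishingOn θ.ker ⊆ sigmaStar R G r) :
    r ≤ n ∧ cd R θ.ker = ((n - r : ℕ) : WithBot ℕ∞) := by
  obtain ⟨n', hn', P, hfin⟩ := hG
  obtain rfl : n' = n := by exact_mod_cast hn'.symm.trans hn
  have hlt : ∀ k : ℕ, n' < k + r → cd R θ.ker < k := fun k hk =>
    cd_ker_lt hθ hn.le hfin (fun φ hφ i hi => (hS hφ).2 i (by rw [hn]; exact_mod_cast hi)) hk
  have hr : r ≤ n' := by
    by_contra! h
    have hbot : cd R θ.ker = ⊥ := WithBot.lt_coe_bot.1 (hlt 0 (by omega))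
    rw [cd_eq_bot_iff, ← cd_eq_bot_iff R G, hn] at hbot
    exact WithBot.natCast_ne_bot _ hbot
  refine ⟨hr, le_antisymm ?_ (not_lt.1 fun h => ?_)⟩
  · exact (projectiveDimension_le_iff _ _).2 (projectiveDimension_lt_iff.1 (hlt _ (by omega)))
  · have := cd_lt_add hθ h
    rw [Nat.sub_add_cancel hr, hn] at this
    exact lt_irrefl _ this

end Group

theorem complexCd_le_of_subsingleton {B : Type u} [Ring B]
    {C : ChainComplex (ModuleCat.{w} B) ℤ} {n : ℤ} (hC : ∀ i, n < i → Subsingleton (C.X i)) :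
    complexCd C ≤ ((n : WithTop ℤ) : WithBot (WithTop ℤ)) :=
  complexCd_le_iff.2 fun i hi _ => have := hC i hi; .of_subsingleton

theorem exists_surjective_ker_eq {G : Type u} {H : Type v} [Group G] [Group H] {N : Subgroup G}
    [N.Normal] (e : G ⧸ N ≃* H) : ∃ θ : G →* H, Function.Surjective θ ∧ θ.ker = N := by
  refine ⟨e.toMonoidHom.comp (QuotientGroup.mk' N),
    e.surjective.comp (QuotientGroup.mk'_surjective N), ?_⟩
  rw [MonoidHom.ker_comp_of_injective _ _ e.injective, QuotientGroup.ker_mk']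

end CoAbelian

end

theorem theoremE_general (R : Type u) [Ring R] (G : Type v) [Group G] :
    (∀ (d n : ℕ) (N : Subgroup G) [N.Normal],
      CoAbelian.IsFPStar R G d →
      CoAbelian.cd R G = n →
      Nonempty (G ⧸ N ≃* Multiplicative (Fin d → ℤ)) →
      CoAbelian.charactersVanishingOn N ⊆ CoAbelian.sigmaStar R G d →
      d ≤ n ∧ CoAbelian.cd R N = ((n - d : ℕ) : WithBot ℕ∞)) ∧
    (∀ (C : ChainComplex (ModuleCat.{max u v} (MonoidAlgebra R G)) ℤ) (n : ℤ) (d : ℕ)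
      (N : Subgroup G) [N.Normal],
      (∀ i, Module.Projective (MonoidAlgebra R G) (C.X i)) →
      (∀ i, n - d < i → Module.Finite (MonoidAlgebra R G) (C.X i)) →
      CoAbelian.complexCd C ≤ ((n : WithTop ℤ) : WithBot (WithTop ℤ)) →
      Nonempty (G ⧸ N ≃* Multiplicative (Fin d → ℤ)) →
      (∀ φ ∈ CoAbelian.charactersVanishingOn N, ∀ i : ℤ, n - d < i →
        Subsingleton (CoAbelian.cohomology C (CoAbelian.novikovModule R φ) i)) →
      CoAbelian.complexCd (CoAbelian.resComplex R N C) ≤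
        (((n - d : ℤ) : WithTop ℤ) : WithBot (WithTop ℤ))) := by
  refine ⟨fun d n N _ hG hn ⟨e⟩ hS => ?_, fun C n d N _ hproj hfin hcd ⟨e⟩ hv => ?_⟩
  · obtain ⟨θ, hθ, rfl⟩ := CoAbelian.exists_surjective_ker_eq e
    exact CoAbelian.cd_ker_eq hθ hG hn hS
  · obtain ⟨θ, hθ, rfl⟩ := CoAbelian.exists_surjective_ker_eq e
    exact CoAbelian.complexCd_resComplex_le hθ hfin hcd hv

theorem theoremE (R : Type u) [Ring R] [Nontrivial R] (G : Type v) [Group G] :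
    -- the statement for groups
    (∀ (d n : ℕ) (N : Subgroup G) [N.Normal],
      CoAbelian.IsFPStar R G d →
      CoAbelian.cd R G = n →
      Nonempty (G ⧸ N ≃* Multiplicative (Fin d → ℤ)) →
      CoAbelian.charactersVanishingOn N ⊆ CoAbelian.sigmaStar R G d →
      d ≤ n ∧ CoAbelian.cd R N = ((n - d : ℕ) : WithBot ℕ∞)) ∧
    -- the statement for chain complexes
    (∀ (C : ChainComplex (ModuleCat.{max u v} (MonoidAlgebra R G)) ℤ) (n : ℤ) (d : ℕ)
      (χ : CoAbelian.Character G),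
      (∀ i, Module.Projective (MonoidAlgebra R G) (C.X i)) →
      (∀ i, Module.Finite (MonoidAlgebra R G) (C.X i)) →
      (∀ i, n < i → Subsingleton (C.X i)) →
      Nonempty (χ.range ≃* Multiplicative (Fin d → ℤ)) →
      (∀ φ ∈ CoAbelian.charactersVanishingOn χ.ker, ∀ i : ℤ, n - d < i →
        Subsingleton (CoAbelian.cohomology C (CoAbelian.novikovModule R φ) i)) →
      CoAbelian.complexCd (CoAbelian.resComplex R χ.ker C) ≤
        (((n - d : ℤ) : WithTop ℤ) : WithBot (WithTop ℤ))) :=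
  ⟨(theoremE_general R G).1, fun C n d χ hproj hfin hC ⟨e⟩ => (theoremE_general R G).2 C n d χ.ker
    hproj (fun i _ => hfin i) (CoAbelian.complexCd_le_of_subsingleton hC)
    ⟨(QuotientGroup.quotientKerEquivRange χ).trans e⟩⟩
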